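/- Let $r\ge 2$ and let $(G_1,o_1),\dots,(G_r,o_r)$ be rooted simple graphs, each connected, locally finite, quasi-transitive (the automorphism group of $G_i$ has finitely many vertex orbits) and with at least two vertices; write $V_i$ for the vertex set of $G_i$. The vertices of the free product $G=G_1*\dots*G_r$ are the finite words $x_1x_2\cdots x_n$ ($n\ge 0$) over the disjoint union of the sets $V_i\setminus\{o_i\}$ in which no two consecutive letters come from the same set $V_i\setminus\{o_i\}$; the empty word $o$ is the root, and each $o_i$ is identified with $o$. The edges of $G$ are the pairs $wx\sim wy$, where $x\sim y$ is an edge of some $G_i$ and $w$ is a word whose last letter (if any) is not from $V_i\setminus\{o_i\}$. Let $\sigma_n$ be the number of self-avoiding walks of length $n$ on $G$ starting at $o$. Exclude the case in which $r=2$ and $G_1,G_2$ are two finite stars with different numbers of leaves, each rooted at its centre (a single edge counts as a star with one leaf, rooted at either end). Then the connective constant $\mu(G)=\lim_{n\to\infty}\sigma_n^{1/n}$ exists and there is a constant $A_G>0$ such that $$\sigma_n\sim A_G\,\mu(G)^n ,\qquad\text{i.e. } \frac{\sigma_n}{A_G\,\mu(G)^n}\to 1 \text{ as } n\to\infty .$$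 Consequently the critical exponent of $G$ is $\gamma=1$: for real $\gamma$, there is a constant $A>0$ with $\sigma_n\sim A\,\mu(G)^n n^{1-\gamma}$ if and only if $\gamma=1$. -/

import Mathlib

open Filter Topology

namespace FreeProductSAW

universe u v

/-! ### Self-avoiding walks on a rooted graph -/

section Graph

variable {W : Type u}

/-- The number of `n`-step self-avoiding walks on `G` that start at `o`. -/
noncomputable def sawCount (G : SimpleGraph W) (o : W) (n : ℕ) : ℕ :=
  Nat.card (Σ x : W, {p : G.Walk o x // p.IsPath ∧ p.length = n})

/-- `μ` is the connective constant of the rooted graph `(G, o)`: the limit of `σ_n ^ (1 / n)`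
exists and equals `μ`. -/
def IsConnectiveConstant (G : SimpleGraph W) (o : W) (μ : ℝ) : Prop :=
  Tendsto (fun n : ℕ => (sawCount G o n : ℝ) ^ (1 / (n : ℝ))) atTop (𝓝 μ)

/-- `σ_n ∼ A μ ^ n n ^ (1 - γ)` for some constant `A > 0`, where `μ` is the connective constant. -/
def IsCriticalExponent (G : SimpleGraph W) (o : W) (γ : ℝ) : Prop :=
  ∃ μ : ℝ, IsConnectiveConstant G o μ ∧ ∃ A : ℝ, 0 < A ∧
    Tendsto (fun n : ℕ => (sawCount G o n : ℝ) / (A * μ ^ n * (n : ℝ) ^ (1 - γ))) atTop (𝓝 1)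

/-- The automorphism group acts with finitely many orbits. -/
def IsQuasiTransitive (G : SimpleGraph W) : Prop :=
  ∃ S : Set W, S.Finite ∧ ∀ x : W, ∃ s ∈ S, ∃ φ : G ≃g G, φ s = x

/-- Every edge contains `o`. A connected graph with this property is a star with centre `o`. -/
def IsStarAt (G : SimpleGraph W) (o : W) : Prop :=
  ∀ x y : W, G.Adj x y → x = o ∨ y = o

end Graph

/-! ### Free products of rooted graphs -/

section FreeProduct

variable {ι : Type u} {V : ι → Type v}

/-- The letters: the disjoint union of the sets `V i \ {o i}`. The type `τ` of a letter is its
first component. -/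
abbrev Letter (o : ∀ i, V i) : Type (max u v) :=
  Σ i : ι, {x : V i // x ≠ o i}

/-- The words `x₁ x₂ … xₙ` over the letters, `n ≥ 0`, with consecutive letters of different type. -/
def Word (o : ∀ i, V i) : Type (max u v) :=
  {l : List (Letter o) // l.IsChain fun a b => a.1 ≠ b.1}

/-- The empty word. -/
def Word.empty (o : ∀ i, V i) : Word o :=
  ⟨[], List.isChain_nil⟩

open Classical in
/-- A vertex of `V i` as a word with at most one letter; the root `o i` is the empty word. -/
noncomputable def single (o : ∀ i, V i) (i : ι) (x : V i) : List (Letter o) :=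
  if h : x = o i then [] else [⟨i, x, h⟩]

theorem single_injective (o : ∀ i, V i) (i : ι) : Function.Injective (single o i) := by
  intro x y h
  unfold single at h
  split_ifs at h with hx hy hy
  · rw [hx, hy]
  · simpa using h

/-- The free product of the rooted graphs `(G i, o i)`: the edges are `w x ∼ w y`, where `x ∼ y` is
an edge of `G i` and the word `w` does not end in a letter of type `i`. -/
def freeProduct (G : ∀ i, SimpleGraph (V i)) (o : ∀ i, V i) : SimpleGraph (Word o) where
  Adj a b := ∃ (w : Word o) (i : ι) (x y : V i),
    (∀ c ∈ w.1.getLast?, c.1 ≠ i) ∧ (G i).Adj x y ∧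
      a.1 = w.1 ++ single o i x ∧ b.1 = w.1 ++ single o i y
  symm := by
    constructor
    rintro a b ⟨w, i, x, y, hw, hxy, ha, hb⟩
    exact ⟨w, i, y, x, hw, hxy.symm, hb, ha⟩
  loopless := by
    constructor
    rintro a ⟨w, i, x, y, -, hxy, ha, hb⟩
    exact hxy.ne (single_injective o i (List.append_cancel_left (ha.symm.trans hb)))

end FreeProduct

end FreeProductSAW

/-!
Fix a factor `G i`. A self-avoiding walk of the free product that starts at the root is cut at the
last of its vertices that is a word not ending in type `i`; from there on it stays in one copy of
`G i`. Hence `σ = M_i N_i`, where `σ` and `M_i` are the generating series of the walks of the free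
product and of `G i`, and `N_i` counts the walks whose endpoint does not end in type `i`. Since
`σ - 1 = ∑ i, (σ - N_i)`, this gives `σ⁻¹ = 1 + ∑ i, (M_i⁻¹ - 1)`. For two series this says
`σ = M N U`, where `U = 1 / (1 - F)` with `F = (M - 1) (N - 1)`.

For a quasi-transitive graph, counting walks from orbit representatives gives a submultiplicative
sequence, so `M_i` diverges at its radius of convergence. Therefore `F` reaches the value `1` at
some `ρ` strictly inside its disc of convergence, and `f_n ρⁿ` is a probability distribution. By the
renewal theorem the coefficients of `U` times `ρⁿ` converge, and hence so do those of `σ`. More than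
two factors are combined one at a time, as `M N U` again diverges at its radius of convergence `ρ`.

The distribution has period `1` if there are three factors, or if a factor has a self-avoiding walk
of length two. Otherwise both factors are stars of degrees `c` and `d`, and `F = c d X²`; for
`c = d` the series is `(1 + d X) / (1 - d X)`.
-/

namespace FreeProductSAW

section SelfAvoidingWalks

variable {W W' : Type*} {G : SimpleGraph W} {G' : SimpleGraph W'} {o x y : W}
  {l t A B : List W} {m n : ℕ}

/-- The list of vertices of a self-avoiding walk from `o`, read backwards: the head is the endpoint
and the last entry is `o`, so that a walk is extended by `List.cons`. -/
structure IsSAW (G : SimpleGraph W) (o : W) (l : List W) : Prop where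
  isChain : l.IsChain G.Adj
  nodup : l.Nodup
  getLast? : l.getLast? = some o

theorem isSAW_singleton : IsSAW G o [x] ↔ x = o := by
  constructor
  · intro h
    simpa using h.getLast?
  · rintro rfl
    exact ⟨List.isChain_singleton x, List.nodup_singleton x, rfl⟩

theorem isSAW_cons_cons :
    IsSAW G o (x :: y :: t) ↔ G.Adj x y ∧ x ∉ y :: t ∧ IsSAW G o (y :: t) := by
  constructor
  · rintro ⟨hc, hnd, hlast⟩
    rw [List.isChain_cons_cons] at hc
    rw [List.nodup_cons] at hnd
    exact ⟨hc.1, hnd.1, hc.2, hnd.2, by rwa [List.getLast?_cons_cons] at hlast⟩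
  · rintro ⟨hxy, hx, h⟩
    exact ⟨h.isChain.cons_cons hxy, h.nodup.cons hx, by rw [List.getLast?_cons_cons, h.getLast?]⟩

theorem IsSAW.exists_eq_cons (h : IsSAW G o l) : ∃ x t, l = x :: t :=
  List.exists_cons_of_ne_nil fun hl => by simpa [hl] using h.getLast?

theorem IsSAW.exists_eq_concat (h : IsSAW G o l) : ∃ t, l = t ++ [o] :=
  List.getLast?_eq_some_iff.1 h.getLast?

theorem IsSAW.mem (h : IsSAW G o l) : o ∈ l :=
  List.mem_of_getLast? h.getLast?

theorem IsSAW.left_of_append (h : IsSAW G o (A ++ x :: B)) : IsSAW G x (A ++ [x]) :=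
  ⟨(List.isChain_split.1 h.isChain).1, h.nodup.sublist (by simp), by simp⟩

theorem IsSAW.right_of_append (h : IsSAW G o (A ++ x :: B)) : IsSAW G o (x :: B) :=
  ⟨(List.isChain_split.1 h.isChain).2, h.nodup.sublist (List.sublist_append_right _ _),
    by simpa [List.getLast?_append] using h.getLast?⟩

theorem IsSAW.append (hA : IsSAW G x (A ++ [x])) (hB : IsSAW G o (x :: B))
    (hdisj : A.Disjoint (x :: B)) : IsSAW G o (A ++ x :: B) :=
  ⟨List.isChain_split.2 ⟨hA.isChain, hB.isChain⟩,
    (hA.nodup.sublist (List.sublist_append_left _ _)).append hB.nodup hdisj,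
    by rw [List.getLast?_append_cons, hB.getLast?]⟩

theorem IsSAW.concat (h : IsSAW G x l) (hxo : G.Adj x o) (ho : o ∉ l) : IsSAW G o (l ++ [o]) := by
  obtain ⟨t, rfl⟩ := h.exists_eq_concat
  rw [List.append_assoc, List.singleton_append]
  refine h.append (isSAW_cons_cons.2 ⟨hxo, by simpa using hxo.ne, isSAW_singleton.2 rfl⟩) ?_
  have hnd := h.nodup
  simp only [List.nodup_append', List.mem_append, List.mem_singleton, not_or,
    List.disjoint_cons_right, List.disjoint_nil_right, and_true] at hnd ho ⊢
  exact ⟨hnd.2.2, ho.1⟩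

theorem IsSAW.reverse (h : IsSAW G o (x :: B)) : IsSAW G x (x :: B).reverse :=
  ⟨List.isChain_reverse.2 (h.isChain.imp fun _ _ hab => hab.symm), List.nodup_reverse.2 h.nodup,
    by simp⟩

theorem IsSAW.map (h : IsSAW G o l) {f : W → W'} (hf : Function.Injective f)
    (hadj : ∀ ⦃x y⦄, G.Adj x y → G'.Adj (f x) (f y)) : IsSAW G' (f o) (l.map f) :=
  ⟨(List.isChain_map f).2 (h.isChain.imp hadj), h.nodup.map hf, by simp [h.getLast?]⟩

/-- The `n`-step self-avoiding walks from `o`, in the encoding of `IsSAW`. -/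
def saws (G : SimpleGraph W) (o : W) (n : ℕ) : Set (List W) :=
  {l | IsSAW G o l ∧ l.length = n + 1}

theorem mem_saws_zero : l ∈ saws G o 0 ↔ l = [o] := by
  constructor
  · rintro ⟨h, hlen⟩
    obtain ⟨x, rfl⟩ := List.length_eq_one_iff.1 hlen
    rw [isSAW_singleton.1 h]
  · rintro rfl
    exact ⟨isSAW_singleton.2 rfl, rfl⟩

theorem cons_cons_mem_saws :
    x :: y :: t ∈ saws G o (n + 1) ↔ G.Adj x y ∧ x ∉ y :: t ∧ y :: t ∈ saws G o n := by
  simp only [saws, Set.mem_ofPred_eq, isSAW_cons_cons, List.length_cons, Nat.add_right_cancel_iff,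
    and_assoc]

theorem exists_eq_cons_cons_of_mem_saws (h : l ∈ saws G o (n + 1)) : ∃ x y t, l = x :: y :: t := by
  obtain ⟨x, t, rfl⟩ := h.1.exists_eq_cons
  have hlen : t.length = n + 1 := by simpa using h.2
  obtain ⟨y, t, rfl⟩ := List.exists_cons_of_length_eq_add_one hlen
  exact ⟨x, y, t, rfl⟩

theorem isSAW_reverse_support (p : G.Walk o x) (hp : p.IsPath) : IsSAW G o p.support.reverse :=
  ⟨List.isChain_reverse.2 (p.isChain_adj_support.imp fun _ _ h => h.symm),
    List.nodup_reverse.2 hp.support_nodup, by cases p <;> simp⟩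

theorem IsSAW.exists_walk (h : IsSAW G o l) :
    ∃ (x : W) (p : G.Walk o x), p.IsPath ∧ p.support.reverse = l := by
  have hne : l.reverse ≠ [] := by
    obtain ⟨x, t, rfl⟩ := h.exists_eq_cons
    simp
  have hhead : l.reverse.head hne = o := by
    rw [← Option.some_inj, ← List.head?_eq_some_head hne, List.head?_reverse, h.getLast?]
  have hchain : l.reverse.IsChain G.Adj :=
    List.isChain_reverse.2 (h.isChain.imp fun _ _ h => h.symm)
  refine ⟨_, (SimpleGraph.Walk.ofSupport l.reverse hne hchain).copy hhead rfl, ?_, ?_⟩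
  · rw [SimpleGraph.Walk.isPath_def, SimpleGraph.Walk.support_copy,
      SimpleGraph.Walk.support_ofSupport, List.nodup_reverse]
    exact h.nodup
  · rw [SimpleGraph.Walk.support_copy, SimpleGraph.Walk.support_ofSupport, List.reverse_reverse]

theorem sawCount_eq_ncard (G : SimpleGraph W) (o : W) (n : ℕ) :
    sawCount G o n = (saws G o n).ncard := by
  rw [sawCount, ← Nat.card_coe_set_eq]
  refine Nat.card_eq_of_bijective (fun p => ⟨p.2.1.support.reverse,
    isSAW_reverse_support p.2.1 p.2.2.1, by simp [p.2.2.2]⟩) ⟨?_, ?_⟩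
  · rintro ⟨x, p, hp, hpn⟩ ⟨y, q, hq, hqn⟩ h
    have hsupp : p.support = q.support :=
      List.reverse_injective (congrArg Subtype.val h)
    obtain rfl : x = y := by
      rw [← p.getLast_support, ← q.getLast_support]
      simp only [hsupp]
    obtain rfl : p = q := SimpleGraph.Walk.ext_support hsupp
    rfl
  · rintro ⟨l, hl, hlen⟩
    obtain ⟨x, p, hp, rfl⟩ := hl.exists_walk
    exact ⟨⟨x, p, hp, by simpa using hlen⟩, rfl⟩

theorem finite_saws (hfin : ∀ x, (G.neighborSet x).Finite) (o : W) (n : ℕ) :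
    (saws G o n).Finite := by
  induction n with
  | zero => exact (Set.finite_singleton [o]).subset fun l hl => mem_saws_zero.1 hl
  | succ n ih =>
    refine (ih.biUnion (t := fun l => (· :: l) '' G.neighborSet (l.headD o)) fun l _ =>
      (hfin _).image _).subset fun l hl => ?_
    obtain ⟨x, y, t, rfl⟩ := exists_eq_cons_cons_of_mem_saws hl
    obtain ⟨hxy, -, ht⟩ := cons_cons_mem_saws.1 hl
    exact Set.mem_biUnion ht ⟨x, hxy.symm, rfl⟩

/-- `saws` as a finset, for a locally finite graph. -/
noncomputable def sawFinset (hfin : ∀ x, (G.neighborSet x).Finite) (o : W) (n : ℕ) :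
    Finset (List W) :=
  (finite_saws hfin o n).toFinset

theorem mem_sawFinset (hfin : ∀ x, (G.neighborSet x).Finite) :
    l ∈ sawFinset hfin o n ↔ l ∈ saws G o n :=
  (finite_saws hfin o n).mem_toFinset

theorem card_sawFinset (hfin : ∀ x, (G.neighborSet x).Finite) (o : W) (n : ℕ) :
    (sawFinset hfin o n).card = sawCount G o n := by
  rw [sawCount_eq_ncard, sawFinset, Set.ncard_eq_toFinset_card _ (finite_saws hfin o n)]

theorem sawCount_zero (G : SimpleGraph W) (o : W) : sawCount G o 0 = 1 := by
  rw [sawCount_eq_ncard, Set.ncard_eq_one]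
  exact ⟨[o], Set.ext fun l => mem_saws_zero⟩

theorem sawCount_one (G : SimpleGraph W) (o : W) : sawCount G o 1 = (G.neighborSet o).ncard := by
  have hsaws : saws G o 1 = (fun x => [x, o]) '' G.neighborSet o := by
    ext l
    constructor
    · intro hl
      obtain ⟨x, y, t, rfl⟩ := exists_eq_cons_cons_of_mem_saws hl
      obtain ⟨hxy, -, ht⟩ := cons_cons_mem_saws.1 hl
      rw [mem_saws_zero] at ht
      obtain ⟨rfl, rfl⟩ := List.cons.inj ht
      exact ⟨x, hxy.symm, rfl⟩
    · rintro ⟨x, hx, rfl⟩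
      exact cons_cons_mem_saws.2 ⟨hx.symm, by simpa using hx.ne', mem_saws_zero.2 rfl⟩
  rw [sawCount_eq_ncard, hsaws, Set.ncard_image_of_injective]
  intro x y h
  simpa using h

theorem sawCount_add_le (hfin : ∀ x, (G.neighborSet x).Finite) (o : W) (m n : ℕ) {S : ℕ}
    (hS : ∀ x, sawCount G x n ≤ S) : sawCount G o (m + n) ≤ sawCount G o m * S := by
  classical
  have hcover : sawFinset hfin o (m + n) ⊆ (sawFinset hfin o m).biUnion fun B =>
      (sawFinset hfin (B.headD o) n).image (· ++ B.tail) := by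
    intro l hl
    obtain ⟨hl, hlen⟩ := (mem_sawFinset hfin).1 hl
    obtain ⟨A, x, B, rfl, hA⟩ : ∃ A x B, l = A ++ x :: B ∧ A.length = n :=
      ⟨l.take n, l[n], l.drop (n + 1), by simp, by simp; lia⟩
    rw [List.length_append, List.length_cons] at hlen
    refine Finset.mem_biUnion.2 ⟨x :: B, (mem_sawFinset hfin).2 ⟨hl.right_of_append, ?_⟩,
      Finset.mem_image.2 ⟨A ++ [x], (mem_sawFinset hfin).2 ⟨hl.left_of_append, by simp [hA]⟩, ?_⟩⟩
    · rw [List.length_cons]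
      lia
    · simp
  rw [← card_sawFinset hfin, ← card_sawFinset hfin o m]
  refine (Finset.card_le_card hcover).trans
    (Finset.card_biUnion_le_card_mul _ _ _ fun B _ => Finset.card_image_le.trans ?_)
  rw [card_sawFinset]
  exact hS _

/-- A walk from the neighbour `x` of `o` either avoids `o`, and is continued to `o` by one step, or
splits at `o` into two walks that start at `o`. -/
theorem sawCount_le_of_adj (hfin : ∀ x, (G.neighborSet x).Finite) (hxo : G.Adj x o) (n : ℕ) :
    sawCount G x n ≤ sawCount G o (n + 1) +
      ∑ k ∈ Finset.HasAntidiagonal.antidiagonal n, sawCount G o k.1 * sawCount G o k.2 := by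
  classical
  have hcover : sawFinset hfin x n ⊆ (sawFinset hfin o (n + 1)).image List.dropLast ∪
      (Finset.HasAntidiagonal.antidiagonal n).biUnion fun k =>
        Finset.image₂ (fun p q => p ++ q.reverse.tail) (sawFinset hfin o k.1)
          (sawFinset hfin o k.2) := by
    intro l hl
    obtain ⟨hl, hlen⟩ := (mem_sawFinset hfin).1 hl
    rw [Finset.mem_union]
    by_cases ho : o ∈ l
    · obtain ⟨A, B, rfl⟩ := List.append_of_mem ho
      rw [List.length_append, List.length_cons] at hlen
      refine Or.inr (Finset.mem_biUnion.2 ⟨(A.length, B.length),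
        Finset.HasAntidiagonal.mem_antidiagonal.2 (by lia), Finset.mem_image₂.2
          ⟨A ++ [o], (mem_sawFinset hfin).2 ⟨hl.left_of_append, by simp⟩,
            (o :: B).reverse, (mem_sawFinset hfin).2 ⟨hl.right_of_append.reverse, by simp⟩, ?_⟩⟩)
      simp
    · exact Or.inl (Finset.mem_image.2 ⟨l ++ [o],
        (mem_sawFinset hfin).2 ⟨hl.concat hxo ho, by simp [hlen]⟩, List.dropLast_concat⟩)
  simp only [← card_sawFinset hfin]
  refine (Finset.card_le_card hcover).trans ((Finset.card_union_le _ _).trans ?_)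
  exact add_le_add Finset.card_image_le
    (Finset.card_biUnion_le.trans (Finset.sum_le_sum fun k _ => Finset.card_image₂_le _ _ _))

theorem sawCount_iso (φ : G ≃g G') (o : W) (n : ℕ) : sawCount G' (φ o) n = sawCount G o n := by
  have hsaws : saws G' (φ o) n = List.map φ '' saws G o n := by
    ext l
    constructor
    · rintro ⟨hl, hlen⟩
      have hl' := hl.map φ.symm.injective fun _ _ => φ.symm.map_adj_iff.2
      rw [φ.symm_apply_apply] at hl'
      exact ⟨l.map φ.symm, ⟨hl', by simpa using hlen⟩, by simp [Function.comp_def]⟩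
    · rintro ⟨l, ⟨hl, hlen⟩, rfl⟩
      exact ⟨hl.map φ.injective fun _ _ => φ.map_adj_iff.2, by simpa using hlen⟩
  rw [sawCount_eq_ncard, sawCount_eq_ncard, hsaws,
    Set.ncard_image_of_injective _ (List.map_injective_iff.2 φ.injective)]

theorem sawCount_eq_zero_of_le (hfin : ∀ x, (G.neighborSet x).Finite) (hmn : m ≤ n)
    (h : sawCount G o m = 0) : sawCount G o n = 0 := by
  induction n, hmn using Nat.le_induction with
  | base => exact h
  | succ n _ ih =>
    rw [sawCount_eq_ncard, Set.ncard_eq_zero (finite_saws hfin _ _)] at ih ⊢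
    refine Set.eq_empty_of_forall_notMem fun l hl => ?_
    obtain ⟨x, y, t, rfl⟩ := exists_eq_cons_cons_of_mem_saws hl
    exact Set.notMem_empty _ (ih ▸ (cons_cons_mem_saws.1 hl).2.2)

end SelfAvoidingWalks

section NonnegSeries

open PowerSeries

variable {F H : ℝ⟦X⟧} {z w : ℝ}

/-- A real power series with nonnegative coefficients. -/
def CoeffNonneg (F : ℝ⟦X⟧) : Prop :=
  ∀ n, 0 ≤ coeff n F

theorem coeffNonneg_one : CoeffNonneg 1 := fun n => by
  rw [coeff_one]
  split_ifs <;> norm_num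

theorem CoeffNonneg.mul (hF : CoeffNonneg F) (hH : CoeffNonneg H) : CoeffNonneg (F * H) := by
  intro n
  rw [coeff_mul]
  exact Finset.sum_nonneg fun p _ => mul_nonneg (hF _) (hH _)

theorem CoeffNonneg.rescale (hF : CoeffNonneg F) (hz : 0 ≤ z) :
    CoeffNonneg (PowerSeries.rescale z F) := fun n => by
  rw [coeff_rescale]
  exact mul_nonneg (pow_nonneg hz n) (hF n)

theorem CoeffNonneg.sub_one (hF : CoeffNonneg F) (hF0 : coeff 0 F = 1) : CoeffNonneg (F - 1) :=
  fun n => by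
    rw [map_sub, coeff_one]
    split_ifs with hn
    · rw [hn, hF0, sub_self]
    · rw [sub_zero]
      exact hF n

theorem CoeffNonneg.coeff_mul_coeff_le (hF : CoeffNonneg F) (hH : CoeffNonneg H) (i j : ℕ) :
    coeff i F * coeff j H ≤ coeff (i + j) (F * H) := by
  rw [coeff_mul]
  exact Finset.single_le_sum (f := fun p : ℕ × ℕ => coeff p.1 F * coeff p.2 H)
    (fun p _ => mul_nonneg (hF _) (hH _)) (show (i, j) ∈ Finset.HasAntidiagonal.antidiagonal (i + j)
      from Finset.HasAntidiagonal.mem_antidiagonal.2 rfl)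

theorem CoeffNonneg.coeff_mul_pos (hF : CoeffNonneg F) (hH : CoeffNonneg H) {i j : ℕ}
    (hi : 0 < coeff i F) (hj : 0 < coeff j H) : 0 < coeff (i + j) (F * H) :=
  (mul_pos hi hj).trans_le (hF.coeff_mul_coeff_le hH i j)

/-- The power series `F` converges at `z`. -/
def SummableAt (F : ℝ⟦X⟧) (z : ℝ) : Prop :=
  Summable fun n => coeff n F * z ^ n

/-- The sum of the power series `F` at `z`; it is meaningful when `SummableAt F z`. -/
noncomputable def evalAt (F : ℝ⟦X⟧) (z : ℝ) : ℝ :=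
  ∑' n, coeff n F * z ^ n

theorem SummableAt.mono (hF : CoeffNonneg F) (h : SummableAt F w) (hz : 0 ≤ z) (hzw : z ≤ w) :
    SummableAt F z :=
  Summable.of_nonneg_of_le (fun n => mul_nonneg (hF n) (pow_nonneg hz n))
    (fun n => mul_le_mul_of_nonneg_left (pow_le_pow_left₀ hz hzw n) (hF n)) h

theorem evalAt_mono (hF : CoeffNonneg F) (h : SummableAt F w) (hz : 0 ≤ z) (hzw : z ≤ w) :
    evalAt F z ≤ evalAt F w :=
  (h.mono hF hz hzw).tsum_le_tsum
    (fun n => mul_le_mul_of_nonneg_left (pow_le_pow_left₀ hz hzw n) (hF n)) h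

theorem evalAt_nonneg (hF : CoeffNonneg F) (hz : 0 ≤ z) : 0 ≤ evalAt F z :=
  tsum_nonneg fun n => mul_nonneg (hF n) (pow_nonneg hz n)

theorem evalAt_pos (hF : CoeffNonneg F) (hz : 0 < z) (h : SummableAt F z) {n : ℕ}
    (hn : 0 < coeff n F) : 0 < evalAt F z :=
  h.tsum_pos (fun n => mul_nonneg (hF n) (pow_nonneg hz.le n)) n (mul_pos hn (pow_pos hz n))

theorem continuousOn_evalAt (hF : CoeffNonneg F) (h : SummableAt F w) :
    ContinuousOn (evalAt F) (Set.Icc 0 w) := by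
  refine continuousOn_tsum (u := fun n => coeff n F * w ^ n) (fun n => by fun_prop) h ?_
  rintro n z ⟨hz, hzw⟩
  rw [Real.norm_of_nonneg (mul_nonneg (hF n) (pow_nonneg hz n))]
  exact mul_le_mul_of_nonneg_left (pow_le_pow_left₀ hz hzw n) (hF n)

theorem evalAt_zero (F : ℝ⟦X⟧) : evalAt F 0 = coeff 0 F := by
  rw [evalAt, tsum_eq_single 0 fun n hn => by rw [zero_pow hn, mul_zero], pow_zero, mul_one]

theorem hasSum_one_mul_pow (z : ℝ) : HasSum (fun n => coeff n (1 : ℝ⟦X⟧) * z ^ n) 1 := by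
  have h := hasSum_single (f := fun n => coeff n (1 : ℝ⟦X⟧) * z ^ n) 0 fun n hn => by
    rw [coeff_one, if_neg hn, zero_mul]
  rwa [coeff_zero_one, pow_zero, mul_one] at h

theorem SummableAt.sub (hF : SummableAt F z) (hH : SummableAt H z) : SummableAt (F - H) z :=
  (Summable.sub hF hH).congr fun n => by rw [map_sub, sub_mul]

theorem evalAt_sub (hF : SummableAt F z) (hH : SummableAt H z) :
    evalAt (F - H) z = evalAt F z - evalAt H z := by
  rw [evalAt, evalAt, evalAt, ← Summable.tsum_sub hF hH]
  exact tsum_congr fun n => by rw [map_sub, sub_mul]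

theorem SummableAt.sub_one (hF : SummableAt F z) : SummableAt (F - 1) z :=
  hF.sub (hasSum_one_mul_pow z).summable

theorem evalAt_sub_one (hF : SummableAt F z) : evalAt (F - 1) z = evalAt F z - 1 := by
  rw [evalAt_sub hF (hasSum_one_mul_pow z).summable, evalAt, evalAt, (hasSum_one_mul_pow z).tsum_eq]

theorem SummableAt.norm (hF : SummableAt F z) : Summable fun n => ‖coeff n F * z ^ n‖ :=
  Summable.norm hF

theorem coeff_mul_mul_pow (F H : ℝ⟦X⟧) (z : ℝ) (n : ℕ) :
    coeff n (F * H) * z ^ n = ∑ p ∈ Finset.HasAntidiagonal.antidiagonal n,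
      (coeff p.1 F * z ^ p.1) * (coeff p.2 H * z ^ p.2) := by
  rw [coeff_mul, Finset.sum_mul]
  refine Finset.sum_congr rfl fun p hp => ?_
  rw [← Finset.HasAntidiagonal.mem_antidiagonal.1 hp, pow_add, mul_mul_mul_comm]

theorem SummableAt.mul (hF : SummableAt F z) (hH : SummableAt H z) : SummableAt (F * H) z :=
  (summable_norm_sum_mul_antidiagonal_of_summable_norm hF.norm hH.norm).of_norm.congr
    fun n => (coeff_mul_mul_pow F H z n).symm

theorem evalAt_mul (hF : SummableAt F z) (hH : SummableAt H z) :
    evalAt (F * H) z = evalAt F z * evalAt H z := by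
  rw [evalAt, evalAt, evalAt,
    tsum_mul_tsum_eq_tsum_sum_antidiagonal_of_summable_norm hF.norm hH.norm]
  exact tsum_congr fun n => coeff_mul_mul_pow F H z n

theorem hasSum_coeff_rescale (h : SummableAt F z) :
    HasSum (fun n => coeff n (rescale z F)) (evalAt F z) :=
  (Summable.hasSum h).congr_fun fun n => by rw [coeff_rescale, mul_comm]

theorem exists_lt_evalAt_of_not_summableAt (hF : CoeffNonneg F) {R : ℝ} (hR : 0 < R)
    (hlt : ∀ z, 0 < z → z < R → SummableAt F z) (hnot : ¬ SummableAt F R) (K : ℝ) :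
    ∃ z, 0 < z ∧ SummableAt F z ∧ K < evalAt F z := by
  obtain ⟨N, hN⟩ : ∃ N, K < ∑ n ∈ Finset.range N, coeff n F * R ^ n := by
    by_contra! hbdd
    exact hnot (summable_of_sum_range_le (fun n => mul_nonneg (hF n) (pow_nonneg hR.le n)) hbdd)
  have hcont : Continuous fun z : ℝ => ∑ n ∈ Finset.range N, coeff n F * z ^ n := by fun_prop
  have hnear : ∀ᶠ z in 𝓝[<] R, K < ∑ n ∈ Finset.range N, coeff n F * z ^ n :=
    (hcont.continuousAt.eventually (lt_mem_nhds hN)).filter_mono nhdsWithin_le_nhds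
  obtain ⟨z, hKz, hz0, hzR⟩ := (hnear.and (Ioo_mem_nhdsLT hR)).exists
  have hs := hlt z hz0 hzR
  exact ⟨z, hz0, hs, hKz.trans_le
    (hs.sum_le_tsum _ fun n _ => mul_nonneg (hF n) (pow_nonneg hz0.le n))⟩

end NonnegSeries

section Renewal

open PowerSeries

variable {F P : ℝ⟦X⟧} {ρ z : ℝ}

/-- The renewal series `∑ Fᵏ` of a power series `F` without constant term. -/
noncomputable def renewalSeries (F : ℝ⟦X⟧) : ℝ⟦X⟧ :=
  (1 - F)⁻¹

theorem one_sub_mul_renewalSeries (hF0 : coeff 0 F = 0) : (1 - F) * renewalSeries F = 1 := by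
  rw [coeff_zero_eq_constantCoeff_apply] at hF0
  exact PowerSeries.mul_inv_cancel _ (by simp [hF0])

theorem renewalSeries_eq_one_add (hF0 : coeff 0 F = 0) :
    renewalSeries F = 1 + F * renewalSeries F := by
  linear_combination one_sub_mul_renewalSeries hF0

theorem coeff_zero_renewalSeries (hF0 : coeff 0 F = 0) : coeff 0 (renewalSeries F) = 1 := by
  rw [renewalSeries_eq_one_add hF0]
  simpa using Or.inl hF0

theorem coeffNonneg_renewalSeries (hF : CoeffNonneg F) (hF0 : coeff 0 F = 0) :
    CoeffNonneg (renewalSeries F) := fun n => by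
  induction n using Nat.strong_induction_on with
  | _ n ih =>
    rw [renewalSeries_eq_one_add hF0, map_add, coeff_mul]
    refine add_nonneg (coeffNonneg_one n) (Finset.sum_nonneg fun p hp => ?_)
    rcases Nat.eq_zero_or_pos p.1 with h | h
    · rw [h, hF0, zero_mul]
    · have := Finset.HasAntidiagonal.mem_antidiagonal.1 hp
      exact mul_nonneg (hF _) (ih _ (by lia))

theorem rescale_renewalSeries (hF0 : coeff 0 F = 0) (ρ : ℝ) :
    rescale ρ (renewalSeries F) = renewalSeries (rescale ρ F) := by
  have hF0' : constantCoeff (1 - rescale ρ F) ≠ 0 := by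
    rw [← coeff_zero_eq_constantCoeff_apply, map_sub, coeff_rescale, hF0]
    simp
  rw [renewalSeries.eq_def (rescale ρ F), PowerSeries.eq_inv_iff_mul_eq_one hF0',
    ← map_one (rescale ρ), ← map_sub, ← map_mul, mul_comm, one_sub_mul_renewalSeries hF0]

/-- `F` is the generating series of a probability distribution on the positive integers. -/
structure IsLaw (F : ℝ⟦X⟧) : Prop where
  nonneg : CoeffNonneg F
  coeff_zero : coeff 0 F = 0
  hasSum : HasSum (fun n => coeff n F) 1

/-- The series of the tails `∑_{k > n} f_k` of a distribution `F`; its sum at `1` is the mean. -/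
noncomputable def tailSeries (F : ℝ⟦X⟧) : ℝ⟦X⟧ :=
  (1 - F) * mk 1

theorem coeff_tailSeries (F : ℝ⟦X⟧) (n : ℕ) :
    coeff n (tailSeries F) = 1 - ∑ k ∈ Finset.range (n + 1), coeff k F := by
  rw [tailSeries, sub_mul, one_mul, map_sub, coeff_mul, coeff_mk,
    Finset.Nat.sum_antidiagonal_eq_sum_range_succ_mk]
  simp

theorem tailSeries_mul_renewalSeries (hF0 : coeff 0 F = 0) :
    tailSeries F * renewalSeries F = mk 1 := by
  rw [tailSeries, mul_right_comm, one_sub_mul_renewalSeries hF0, one_mul]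

namespace IsLaw

theorem coeffNonneg_renewalSeries (hF : IsLaw F) : CoeffNonneg (renewalSeries F) :=
  FreeProductSAW.coeffNonneg_renewalSeries hF.nonneg hF.coeff_zero

theorem coeffNonneg_tailSeries (hF : IsLaw F) : CoeffNonneg (tailSeries F) := fun n => by
  rw [coeff_tailSeries, sub_nonneg]
  exact sum_le_hasSum _ (fun n _ => hF.nonneg n) hF.hasSum

theorem coeff_zero_tailSeries (hF : IsLaw F) : coeff 0 (tailSeries F) = 1 := by
  simp [coeff_tailSeries, hF.coeff_zero]

theorem coeff_renewalSeries_mem_Icc (hF : IsLaw F) (n : ℕ) :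
    coeff n (renewalSeries F) ∈ Set.Icc (0 : ℝ) 1 := by
  refine ⟨hF.coeffNonneg_renewalSeries n, ?_⟩
  have h := hF.coeffNonneg_tailSeries.coeff_mul_coeff_le hF.coeffNonneg_renewalSeries 0 n
  rwa [hF.coeff_zero_tailSeries, one_mul, zero_add, tailSeries_mul_renewalSeries hF.coeff_zero,
    coeff_mk, Pi.one_apply] at h

theorem summable_tailSeries (hF : IsLaw F) {r : ℝ} (hr : 1 < r) (hs : SummableAt F r) :
    Summable fun n => coeff n (tailSeries F) := by
  have hr0 : 0 < r := one_pos.trans hr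
  have hgeo : Summable fun n : ℕ => evalAt F r * r⁻¹ ^ n :=
    (summable_geometric_of_lt_one (inv_nonneg.2 hr0.le) (inv_lt_one_of_one_lt₀ hr)).mul_left _
  refine Summable.of_nonneg_of_le hF.coeffNonneg_tailSeries (fun n => ?_) hgeo
  have hbound : ∀ k, coeff k F ≤
      (if k ∈ Finset.range (n + 1) then coeff k F else 0) + coeff k F * r ^ k * r⁻¹ ^ n := by
    intro k
    have hnonneg : 0 ≤ coeff k F * r ^ k * r⁻¹ ^ n :=
      mul_nonneg (mul_nonneg (hF.nonneg k) (by positivity)) (by positivity)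
    split_ifs with hk
    · linarith
    · rw [zero_add, mul_assoc, inv_pow, ← div_eq_mul_inv]
      refine le_mul_of_one_le_right (hF.nonneg k) ((one_le_div (by positivity)).2 ?_)
      exact pow_le_pow_right₀ hr.le (n.le_succ.trans (not_lt.1 (mt Finset.mem_range.2 hk)))
  have hhead : HasSum (fun k => if k ∈ Finset.range (n + 1) then coeff k F else 0)
      (∑ k ∈ Finset.range (n + 1), coeff k F) := by
    rw [← Finset.sum_congr rfl fun k hk => if_pos hk]
    exact hasSum_sum_of_ne_finset_zero fun k hk => if_neg hk
  have htotal := hasSum_le hbound hF.hasSum (hhead.add ((Summable.hasSum hs).mul_right _))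
  rw [coeff_tailSeries]
  exact sub_le_iff_le_add'.2 htotal

end IsLaw

/-- The maximum principle for averages along a probability distribution `f`. -/
theorem eq_of_mem_closure_of_forall_le {f L : ℕ → ℝ} (hf : ∀ k, 0 ≤ f k) (hf1 : HasSum f 1)
    (hL : ∀ j, HasSum (fun k => f k * L (j + k)) (L j)) (hmax : ∀ j, L j ≤ L 0) {n : ℕ}
    (hn : n ∈ AddSubmonoid.closure {k | 0 < f k}) : L n = L 0 := by
  suffices h : ∀ j, L j = L 0 → L (j + n) = L 0 by simpa using h 0 rfl
  induction hn using AddSubmonoid.closure_induction with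
  | zero => exact fun j hj => hj
  | add m n _ _ ihm ihn => exact fun j hj => add_assoc j m n ▸ ihn _ (ihm j hj)
  | mem k hk =>
    intro j hj
    have hdefect : HasSum (fun k => f k * (L 0 - L (j + k))) 0 := by
      have h := (hf1.mul_right (L 0)).sub (hL j)
      rw [one_mul, hj, sub_self] at h
      exact h.congr_fun fun k => mul_sub _ _ _
    have hzero := congrFun ((hasSum_zero_iff_of_nonneg fun k =>
      mul_nonneg (hf k) (sub_nonneg.2 (hmax _))).1 hdefect) k
    rcases mul_eq_zero.1 hzero with h | h
    · exact absurd h (ne_of_gt hk)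
    · exact (sub_eq_zero.1 h).symm

theorem mul_eq_of_forall_le {f T L : ℕ → ℝ} {τ c : ℝ} (hf : ∀ k, 0 ≤ f k) (hf1 : HasSum f 1)
    (hgcd : Nat.setGcd {k | 0 < f k} = 1) (hL : ∀ j, HasSum (fun k => f k * L (j + k)) (L j))
    (hmax : ∀ j, L j ≤ L 0) (hT : HasSum T τ) (hTL : ∀ j, HasSum (fun k => T k * L (j + k)) c) :
    τ * L 0 = c := by
  obtain ⟨N, hN⟩ := Nat.exists_mem_closure_of_ge {k | 0 < f k}
  have hconst : ∀ k, L (N + k) = L 0 := fun k =>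
    eq_of_mem_closure_of_forall_le hf hf1 hL hmax (hN _ (Nat.le_add_right N k)
      (hgcd ▸ one_dvd _))
  have hTL' : HasSum (fun k => T k * L 0) c := by simpa only [hconst] using hTL N
  exact (hT.mul_right (L 0)).unique hTL'

theorem tendsto_coeff_sub_mul {H U : ℝ⟦X⟧} (hH : CoeffNonneg H)
    (hHs : Summable fun n => coeff n H) (hU : ∀ n, coeff n U ∈ Set.Icc (0 : ℝ) 1)
    {l : Filter ℕ} (hl : l ≤ atTop) {L : ℕ → ℝ}
    (hL : ∀ k, Tendsto (fun n => coeff (n - k) U) l (𝓝 (L k))) (j : ℕ) :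
    Tendsto (fun n => coeff (n - j) (H * U)) l (𝓝 (∑' k, coeff k H * L (j + k))) := by
  have hconv : ∀ n, coeff n (H * U) = ∑' k, if k ≤ n then coeff k H * coeff (n - k) U else 0 := by
    intro n
    rw [coeff_mul, Finset.Nat.sum_antidiagonal_eq_sum_range_succ_mk,
      tsum_eq_sum (s := Finset.range (n + 1)) fun k hk =>
        if_neg (by simpa [Nat.lt_succ_iff] using hk)]
    exact Finset.sum_congr rfl fun k hk => (if_pos (by simpa [Nat.lt_succ_iff] using hk)).symm
  simp only [hconv]
  refine tendsto_tsum_of_dominated_convergence hHs (fun k => ?_) (.of_forall fun n k => ?_)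
  · refine ((hL (j + k)).const_mul (coeff k H)).congr' ?_
    filter_upwards [hl (eventually_ge_atTop (j + k))] with n hn
    rw [if_pos (by lia), Nat.sub_sub]
  · split_ifs
    · rw [Real.norm_of_nonneg (mul_nonneg (hH _) (hU _).1)]
      exact mul_le_of_le_one_right (hH _) (hU _).2
    · simpa using hH k

theorem summable_coeff_mul_of_mem_Icc {H : ℝ⟦X⟧} (hH : CoeffNonneg H)
    (hHs : Summable fun n => coeff n H) {L : ℕ → ℝ} (hL : ∀ k, L k ∈ Set.Icc (0 : ℝ) 1) (j : ℕ) :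
    Summable fun k => coeff k H * L (j + k) :=
  hHs.of_nonneg_of_le (fun k => mul_nonneg (hH k) (hL _).1)
    fun k => mul_le_of_le_one_right (hH k) (hL _).2

theorem exists_ultrafilter_tendsto_sub {u : ℕ → ℝ} (hu : ∀ n, u n ∈ Set.Icc (0 : ℝ) 1) {x : ℝ}
    (hx : MapClusterPt x atTop u) : ∃ (l : Ultrafilter ℕ) (L : ℕ → ℝ), ↑l ≤ (atTop : Filter ℕ) ∧
      L 0 = x ∧ (∀ j, L j ∈ Set.Icc (0 : ℝ) 1) ∧ (∀ j, MapClusterPt (L j) atTop u) ∧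
      ∀ j, Tendsto (fun n => u (n - j)) l (𝓝 (L j)) := by
  obtain ⟨l, hl, hlx⟩ := mapClusterPt_iff_ultrafilter.1 hx
  have hlim : ∀ j, ∃ y ∈ Set.Icc (0 : ℝ) 1, Tendsto (fun n => u (n - j)) l (𝓝 y) := fun j =>
    isCompact_Icc.ultrafilter_le_nhds (l.map fun n => u (n - j))
      (le_principal_iff.2 (Eventually.of_forall (f := (l : Filter ℕ)) fun n => hu (n - j)))
  choose L hLmem hL using hlim
  refine ⟨l, L, hl, tendsto_nhds_unique (hL 0) (by simpa using hlx), hLmem, fun j => ?_, hL⟩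
  have hcluster : MapClusterPt (L j) l (u ∘ fun n => n - j) := (hL j).mapClusterPt
  exact hcluster.of_comp ((tendsto_sub_atTop_nat j).mono_left hl)

theorem isCompact_setOf_mapClusterPt {u : ℕ → ℝ} {K : Set ℝ} (hK : IsCompact K)
    (hu : ∀ n, u n ∈ K) : IsCompact {x | MapClusterPt x atTop u} :=
  hK.of_isClosed_subset isClosed_setOfPred_clusterPt fun _ hx =>
    hK.isClosed.mem_of_mapClusterPt hx (.of_forall hu)

namespace IsLaw

/-- The limits `L j` of `u (n - j)` along an ultrafilter inherit the renewal equation and the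
identity `∑ k, T k * u (n - k) = 1` for the tails `T`. -/
theorem exists_backward_limits (hF : IsLaw F) (hT : Summable fun n => coeff n (tailSeries F))
    {x : ℝ} (hx : MapClusterPt x atTop fun n => coeff n (renewalSeries F)) :
    ∃ L : ℕ → ℝ, L 0 = x ∧
      (∀ j, MapClusterPt (L j) atTop fun n => coeff n (renewalSeries F)) ∧
      (∀ j, HasSum (fun k => coeff k F * L (j + k)) (L j)) ∧
      ∀ j, HasSum (fun k => coeff k (tailSeries F) * L (j + k)) 1 := by
  have hU := hF.coeff_renewalSeries_mem_Icc
  obtain ⟨l, L, hl, hL0, hLmem, hcluster, hL⟩ := exists_ultrafilter_tendsto_sub hU hx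
  refine ⟨L, hL0, hcluster, fun j => ?_, fun j => ?_⟩
  · refine (summable_coeff_mul_of_mem_Icc hF.nonneg hF.hasSum.summable hLmem j).hasSum_iff.2 ?_
    refine tendsto_nhds_unique ?_ (hL j)
    refine (tendsto_coeff_sub_mul hF.nonneg hF.hasSum.summable hU hl hL j).congr' ?_
    filter_upwards [hl (eventually_gt_atTop j)] with n hn
    conv_rhs => rw [renewalSeries_eq_one_add hF.coeff_zero, map_add, coeff_one,
      if_neg (by lia), zero_add]
  · refine (summable_coeff_mul_of_mem_Icc hF.coeffNonneg_tailSeries hT hLmem j).hasSum_iff.2 ?_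
    have h := tendsto_coeff_sub_mul hF.coeffNonneg_tailSeries hT hU hl hL j
    rw [tailSeries_mul_renewalSeries hF.coeff_zero] at h
    exact tendsto_nhds_unique h (by simp)

theorem tendsto_coeff_renewalSeries (hF : IsLaw F) (hT : Summable fun n => coeff n (tailSeries F))
    (hgcd : Nat.setGcd {k | 0 < coeff k F} = 1) :
    Tendsto (fun n => coeff n (renewalSeries F)) atTop (𝓝 (∑' n, coeff n (tailSeries F))⁻¹) := by
  have hU := hF.coeff_renewalSeries_mem_Icc
  have hcompact := isCompact_setOf_mapClusterPt isCompact_Icc hU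
  obtain ⟨x₀, -, hx₀⟩ := (isCompact_Icc (a := (0 : ℝ)) (b := 1)).exists_mapClusterPt
    (u := fun n => coeff n (renewalSeries F)) (f := atTop)
    (tendsto_principal.2 (.of_forall hU))
  obtain ⟨x, hx, hxmax⟩ := hcompact.exists_isGreatest ⟨x₀, hx₀⟩
  obtain ⟨y, hy, hymin⟩ := hcompact.exists_isLeast ⟨x₀, hx₀⟩
  have hx_eq : (∑' n, coeff n (tailSeries F)) * x = 1 := by
    obtain ⟨L, rfl, hcluster, hFL, hTL⟩ := hF.exists_backward_limits hT hx
    exact mul_eq_of_forall_le hF.nonneg hF.hasSum hgcd hFL (fun j => hxmax (hcluster j))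
      hT.hasSum hTL
  have hy_eq : (∑' n, coeff n (tailSeries F)) * y = 1 := by
    obtain ⟨L, rfl, hcluster, hFL, hTL⟩ := hF.exists_backward_limits hT hy
    refine neg_injective ((mul_neg _ _).symm.trans ?_)
    exact mul_eq_of_forall_le (L := fun j => -L j) (c := -1) hF.nonneg hF.hasSum hgcd
      (fun j => by simpa only [mul_neg] using (hFL j).neg)
      (fun j => neg_le_neg (hymin (hcluster j))) hT.hasSum
      (fun j => by simpa only [mul_neg] using (hTL j).neg)
  refine isCompact_Icc.tendsto_nhds_of_unique_mapClusterPt (.of_forall hU) fun z _ hz => ?_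
  exact le_antisymm (eq_inv_of_mul_eq_one_right hx_eq ▸ hxmax hz)
    (eq_inv_of_mul_eq_one_right hy_eq ▸ hymin hz)

theorem tendsto_coeff_mul_renewalSeries (hF : IsLaw F)
    (hT : Summable fun n => coeff n (tailSeries F)) (hgcd : Nat.setGcd {k | 0 < coeff k F} = 1)
    (hP : CoeffNonneg P) (hPs : Summable fun n => coeff n P) :
    Tendsto (fun n => coeff n (P * renewalSeries F)) atTop
      (𝓝 ((∑' n, coeff n P) * (∑' n, coeff n (tailSeries F))⁻¹)) := by
  have hlim := hF.tendsto_coeff_renewalSeries hT hgcd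
  have h := tendsto_coeff_sub_mul hP hPs hF.coeff_renewalSeries_mem_Icc le_rfl
    (fun k => hlim.comp (tendsto_sub_atTop_nat k)) 0
  rwa [tsum_mul_right] at h

end IsLaw

/-- The power series `F` without constant term takes the value `1` at the point `ρ > 0` in the
interior of its domain of convergence. Then `f_n ρⁿ` is a probability distribution with an
exponentially decaying tail. -/
structure IsCriticalAt (F : ℝ⟦X⟧) (ρ : ℝ) : Prop where
  nonneg : CoeffNonneg F
  coeff_zero : coeff 0 F = 0
  pos : 0 < ρ
  exists_summableAt : ∃ w, ρ < w ∧ SummableAt F w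
  evalAt_eq_one : evalAt F ρ = 1

namespace IsCriticalAt

theorem summableAt (hF : IsCriticalAt F ρ) : SummableAt F ρ :=
  let ⟨_, hρw, hs⟩ := hF.exists_summableAt
  hs.mono hF.nonneg hF.pos.le hρw.le

theorem isLaw_rescale (hF : IsCriticalAt F ρ) : IsLaw (rescale ρ F) where
  nonneg := hF.nonneg.rescale hF.pos.le
  coeff_zero := by rw [coeff_rescale, hF.coeff_zero, mul_zero]
  hasSum := hF.evalAt_eq_one ▸ hasSum_coeff_rescale hF.summableAt

theorem summable_tailSeries_rescale (hF : IsCriticalAt F ρ) :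
    Summable fun n => coeff n (tailSeries (rescale ρ F)) := by
  obtain ⟨w, hρw, hs⟩ := hF.exists_summableAt
  refine hF.isLaw_rescale.summable_tailSeries ((one_lt_div hF.pos).2 hρw) (hs.congr fun n => ?_)
  rw [coeff_rescale, div_pow, mul_comm (ρ ^ n), mul_assoc,
    mul_div_cancel₀ _ (pow_ne_zero n hF.pos.ne')]

theorem coeffNonneg_renewalSeries (hF : IsCriticalAt F ρ) : CoeffNonneg (renewalSeries F) :=
  FreeProductSAW.coeffNonneg_renewalSeries hF.nonneg hF.coeff_zero

theorem summableAt_renewalSeries (hF : IsCriticalAt F ρ) (hz : 0 ≤ z) (hzρ : z < ρ) :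
    SummableAt (renewalSeries F) z := by
  refine Summable.of_nonneg_of_le
    (fun n => mul_nonneg (hF.coeffNonneg_renewalSeries n) (pow_nonneg hz n)) (fun n => ?_)
    (summable_geometric_of_lt_one (div_nonneg hz hF.pos.le) ((div_lt_one hF.pos).2 hzρ))
  have hle := (hF.isLaw_rescale.coeff_renewalSeries_mem_Icc n).2
  rw [← rescale_renewalSeries hF.coeff_zero, coeff_rescale] at hle
  rw [div_pow, le_div_iff₀ (pow_pos hF.pos n), mul_right_comm, mul_comm (coeff n _)]
  exact mul_le_of_le_one_left (pow_nonneg hz n) hle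

theorem exists_lt_evalAt_renewalSeries (hF : IsCriticalAt F ρ) {K : ℝ} (hK : 0 < K) :
    ∃ z, 0 < z ∧ z < ρ ∧ K < evalAt (renewalSeries F) z := by
  obtain ⟨w, hρw, hs⟩ := hF.exists_summableAt
  have hcont : ContinuousAt (evalAt F) ρ :=
    (continuousOn_evalAt hF.nonneg hs).continuousAt (Icc_mem_nhds hF.pos hρw)
  have hnear : ∀ᶠ z in 𝓝[<] ρ, 1 - K⁻¹ < evalAt F z := by
    refine (hcont.eventually (lt_mem_nhds ?_)).filter_mono nhdsWithin_le_nhds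
    rw [hF.evalAt_eq_one]
    exact sub_lt_self 1 (inv_pos.2 hK)
  obtain ⟨z, hz1, hz0, hzρ⟩ := (hnear.and (Ioo_mem_nhdsLT hF.pos)).exists
  have hFs := hs.mono hF.nonneg hz0.le (hzρ.trans hρw).le
  have hUs := hF.summableAt_renewalSeries hz0.le hzρ
  have hrenewal : evalAt (renewalSeries F) z - 1 = evalAt F z * evalAt (renewalSeries F) z := by
    rw [← evalAt_mul hFs hUs, ← evalAt_sub_one hUs]
    exact congrArg (evalAt · z) (sub_eq_of_eq_add' (renewalSeries_eq_one_add hF.coeff_zero))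
  have hpos : 0 < evalAt (renewalSeries F) z :=
    evalAt_pos hF.coeffNonneg_renewalSeries hz0 hUs
      (one_pos.trans_eq (coeff_zero_renewalSeries hF.coeff_zero).symm)
  refine ⟨z, hz0, hzρ, ?_⟩
  calc K = K * ((1 - evalAt F z) * evalAt (renewalSeries F) z) := by
        linear_combination -K * hrenewal
    _ < K * (K⁻¹ * evalAt (renewalSeries F) z) := by
        gcongr
        linarith
    _ = evalAt (renewalSeries F) z := mul_inv_cancel_left₀ hK.ne' _

theorem exists_tendsto_coeff_mul_renewalSeries (hF : IsCriticalAt F ρ)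
    (hgcd : Nat.setGcd {k | 0 < coeff k F} = 1) (hP : CoeffNonneg P) (hPs : SummableAt P ρ)
    (hPpos : 0 < evalAt P ρ) : ∃ A : ℝ, 0 < A ∧
      Tendsto (fun n => coeff n (P * renewalSeries F) * ρ ^ n) atTop (𝓝 A) := by
  have hlaw := hF.isLaw_rescale
  have hT := hF.summable_tailSeries_rescale
  have hPsum := hasSum_coeff_rescale hPs
  have hsupport : {k | 0 < coeff k (rescale ρ F)} = {k | 0 < coeff k F} := by
    ext k
    simp only [coeff_rescale, Set.mem_ofPred_eq, mul_pos_iff_of_pos_left (pow_pos hF.pos k)]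
  have hmean : 0 < ∑' n, coeff n (tailSeries (rescale ρ F)) :=
    hT.tsum_pos hlaw.coeffNonneg_tailSeries 0 (one_pos.trans_eq hlaw.coeff_zero_tailSeries.symm)
  have hlim := hlaw.tendsto_coeff_mul_renewalSeries hT (hsupport ▸ hgcd)
    (hP.rescale hF.pos.le) hPsum.summable
  rw [hPsum.tsum_eq] at hlim
  refine ⟨_, mul_pos hPpos (inv_pos.2 hmean), hlim.congr fun n => ?_⟩
  rw [← rescale_renewalSeries hF.coeff_zero, ← map_mul, coeff_rescale, mul_comm]

end IsCriticalAt

end Renewal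

section FreeMul

open PowerSeries

variable {M N : ℝ⟦X⟧} {ι : Type*} {s : Finset ι} {i : ι}

/-- The series of a free product of two rooted graphs in terms of the series `M` and `N` of the
factors; it is characterized by `freeMul_eq_inv`. -/
noncomputable def freeMul (M N : ℝ⟦X⟧) : ℝ⟦X⟧ :=
  M * N * renewalSeries ((M - 1) * (N - 1))

theorem coeff_zero_sub_one_mul (hM : coeff 0 M = 1) : coeff 0 ((M - 1) * N) = 0 := by
  rw [coeff_zero_eq_constantCoeff_apply] at *
  rw [map_mul, map_sub, hM, map_one, sub_self, zero_mul]

theorem coeff_zero_freeMul (hM : coeff 0 M = 1) (hN : coeff 0 N = 1) :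
    coeff 0 (freeMul M N) = 1 := by
  have hU := coeff_zero_renewalSeries (coeff_zero_sub_one_mul (N := N - 1) hM)
  rw [coeff_zero_eq_constantCoeff_apply] at *
  rw [freeMul, map_mul, map_mul, hM, hN, hU, one_mul, one_mul]

theorem freeMul_eq_inv (hM : coeff 0 M = 1) (hN : coeff 0 N = 1) :
    freeMul M N = (M⁻¹ + N⁻¹ - 1)⁻¹ := by
  have hU := one_sub_mul_renewalSeries (coeff_zero_sub_one_mul (N := N - 1) hM)
  rw [coeff_zero_eq_constantCoeff_apply] at hM hN
  have hMinv : M * M⁻¹ = 1 := PowerSeries.mul_inv_cancel M (by simp [hM])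
  have hNinv : N * N⁻¹ = 1 := PowerSeries.mul_inv_cancel N (by simp [hN])
  rw [PowerSeries.eq_inv_iff_mul_eq_one (by simp [hM, hN]), freeMul]
  linear_combination hU + N * renewalSeries ((M - 1) * (N - 1)) * hMinv +
    M * renewalSeries ((M - 1) * (N - 1)) * hNinv

/-- The series of a free product of a family of rooted graphs in terms of the series of the
factors. -/
noncomputable def freeProd (s : Finset ι) (M : ι → ℝ⟦X⟧) : ℝ⟦X⟧ :=
  (1 + ∑ i ∈ s, ((M i)⁻¹ - 1))⁻¹

theorem inv_inv_of_constantCoeff_ne_zero (hM : constantCoeff M ≠ 0) : M⁻¹⁻¹ = M := by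
  refine ((PowerSeries.eq_inv_iff_mul_eq_one ?_).2 (PowerSeries.mul_inv_cancel M hM)).symm
  rw [constantCoeff_inv]
  exact inv_ne_zero hM

theorem freeProd_singleton {M : ι → ℝ⟦X⟧} (hM : coeff 0 (M i) = 1) : freeProd {i} M = M i := by
  rw [coeff_zero_eq_constantCoeff_apply] at hM
  rw [freeProd, Finset.sum_singleton, add_sub_cancel,
    inv_inv_of_constantCoeff_ne_zero (hM.trans_ne one_ne_zero)]

theorem coeff_zero_freeProd {M : ι → ℝ⟦X⟧} (hM : ∀ i, coeff 0 (M i) = 1) :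
    coeff 0 (freeProd s M) = 1 := by
  simp only [coeff_zero_eq_constantCoeff_apply] at *
  simp [freeProd, hM]

theorem freeProd_cons {M : ι → ℝ⟦X⟧} (hM : ∀ i, coeff 0 (M i) = 1) (his : i ∉ s) :
    freeProd (s.cons i his) M = freeMul (M i) (freeProd s M) := by
  have hinv : (freeProd s M)⁻¹ = 1 + ∑ i ∈ s, ((M i)⁻¹ - 1) := by
    simp only [coeff_zero_eq_constantCoeff_apply] at hM
    refine inv_inv_of_constantCoeff_ne_zero ?_
    simp [hM]
  rw [freeMul_eq_inv (hM i) (coeff_zero_freeProd hM), hinv, freeProd, Finset.sum_cons]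
  congr 1
  ring

/-- A power series `1 + m₁ X + ⋯` with nonnegative coefficients and `m₁ > 0` whose sum is unbounded
on its domain of convergence in `(0, ∞)`. -/
structure Supercritical (M : ℝ⟦X⟧) : Prop where
  nonneg : CoeffNonneg M
  coeff_zero : coeff 0 M = 1
  coeff_one_pos : 0 < coeff 1 M
  unbounded : ∀ K : ℝ, ∃ z, 0 < z ∧ SummableAt M z ∧ K < evalAt M z

namespace Supercritical

theorem coeffNonneg_sub_one (hM : Supercritical M) : CoeffNonneg (M - 1) :=
  hM.nonneg.sub_one hM.coeff_zero

theorem coeff_sub_one {n : ℕ} (hn : n ≠ 0) : coeff n (M - 1) = coeff n M := by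
  rw [map_sub, coeff_one, if_neg hn, sub_zero]

theorem coeff_one_sub_one_pos (hM : Supercritical M) : 0 < coeff 1 (M - 1) := by
  rw [coeff_sub_one one_ne_zero]
  exact hM.coeff_one_pos

theorem one_le_evalAt (hM : Supercritical M) {z : ℝ} (hz : 0 ≤ z) (hs : SummableAt M z) :
    1 ≤ evalAt M z := by
  have h := evalAt_nonneg hM.coeffNonneg_sub_one hz
  rwa [evalAt_sub_one hs, sub_nonneg] at h

theorem coeffNonneg_sub_one_mul_sub_one (hM : Supercritical M) (hN : Supercritical N) :
    CoeffNonneg ((M - 1) * (N - 1)) :=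
  hM.coeffNonneg_sub_one.mul hN.coeffNonneg_sub_one

theorem exists_one_lt_mul_of_summableAt_imp (hM : Supercritical M) (hN : Supercritical N)
    (hMN : ∀ z, 0 < z → SummableAt M z → SummableAt N z) :
    ∃ z, 0 < z ∧ SummableAt M z ∧ SummableAt N z ∧ 1 < evalAt (M - 1) z * evalAt (N - 1) z := by
  obtain ⟨z₀, hz₀, hMz₀, -⟩ := hM.unbounded 0
  have hNpos := evalAt_pos hN.coeffNonneg_sub_one hz₀ (hMN z₀ hz₀ hMz₀).sub_one
    hN.coeff_one_sub_one_pos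
  obtain ⟨z, hz, hMz, hK⟩ := hM.unbounded (max (1 + (evalAt (N - 1) z₀)⁻¹) (evalAt M z₀))
  obtain ⟨hK₁, hK₂⟩ := max_lt_iff.1 hK
  have hz₀z : z₀ ≤ z := by
    by_contra! hlt
    exact hK₂.not_ge (evalAt_mono hM.nonneg hMz₀ hz.le hlt.le)
  refine ⟨z, hz, hMz, hMN z hz hMz, ?_⟩
  calc 1 = (evalAt (N - 1) z₀)⁻¹ * evalAt (N - 1) z₀ := (inv_mul_cancel₀ hNpos.ne').symm
    _ < evalAt (M - 1) z * evalAt (N - 1) z₀ := by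
        rw [evalAt_sub_one hMz]
        gcongr
        linarith
    _ ≤ evalAt (M - 1) z * evalAt (N - 1) z := by
        refine mul_le_mul_of_nonneg_left ?_ (evalAt_nonneg hM.coeffNonneg_sub_one hz.le)
        exact evalAt_mono hN.coeffNonneg_sub_one (hMN z hz hMz).sub_one hz₀.le hz₀z

theorem exists_one_lt_mul (hM : Supercritical M) (hN : Supercritical N) :
    ∃ z, 0 < z ∧ SummableAt M z ∧ SummableAt N z ∧ 1 < evalAt (M - 1) z * evalAt (N - 1) z := by
  by_cases hMN : ∀ z, 0 < z → SummableAt M z → SummableAt N z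
  · exact hM.exists_one_lt_mul_of_summableAt_imp hN hMN
  · push Not at hMN
    obtain ⟨w, hw, hMw, hNw⟩ := hMN
    have hNM : ∀ z, 0 < z → SummableAt N z → SummableAt M z := by
      intro z hz hNz
      refine hMw.mono hM.nonneg hz.le (le_of_not_gt fun hlt => ?_)
      exact hNw (hNz.mono hN.nonneg hw.le hlt.le)
    obtain ⟨z, hz, hNz, hMz, hlt⟩ := hN.exists_one_lt_mul_of_summableAt_imp hM hNM
    exact ⟨z, hz, hMz, hNz, by rwa [mul_comm]⟩

theorem exists_isCriticalAt (hM : Supercritical M) (hN : Supercritical N) :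
    ∃ ρ, IsCriticalAt ((M - 1) * (N - 1)) ρ ∧ SummableAt M ρ ∧ SummableAt N ρ := by
  obtain ⟨w, hw, hMw, hNw, hlt⟩ := hM.exists_one_lt_mul hN
  have hnonneg := hM.coeffNonneg_sub_one_mul_sub_one hN
  have hzero : coeff 0 ((M - 1) * (N - 1)) = 0 := coeff_zero_sub_one_mul hM.coeff_zero
  have hsw := hMw.sub_one.mul hNw.sub_one
  rw [← evalAt_mul hMw.sub_one hNw.sub_one] at hlt
  obtain ⟨ρ, ⟨hρ, hρw⟩, hρ1⟩ := intermediate_value_Ioo hw.le (continuousOn_evalAt hnonneg hsw)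
    (show (1 : ℝ) ∈ Set.Ioo _ _ from ⟨by rw [evalAt_zero, hzero]; exact one_pos, hlt⟩)
  exact ⟨ρ, ⟨hnonneg, hzero, hρ, ⟨w, hρw, hsw⟩, hρ1⟩, hMw.mono hM.nonneg hρ.le hρw.le,
    hNw.mono hN.nonneg hρ.le hρw.le⟩

theorem coeff_freeMul_pos (hM : Supercritical M) (hN : Supercritical N) {m n : ℕ}
    (hm : 0 < coeff m M) (hn : 0 < coeff n N) : 0 < coeff (m + n) (freeMul M N) := by
  have hzero : coeff 0 ((M - 1) * (N - 1)) = 0 := coeff_zero_sub_one_mul hM.coeff_zero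
  have hU : 0 < coeff 0 (renewalSeries ((M - 1) * (N - 1))) :=
    one_pos.trans_eq (coeff_zero_renewalSeries hzero).symm
  have h := (hM.nonneg.mul hN.nonneg).coeff_mul_pos
    (coeffNonneg_renewalSeries (hM.coeffNonneg_sub_one_mul_sub_one hN) hzero)
    (hM.nonneg.coeff_mul_pos hN.nonneg hm hn) hU
  rwa [add_zero, ← freeMul] at h

protected theorem freeMul (hM : Supercritical M) (hN : Supercritical N) :
    Supercritical (freeMul M N) where
  nonneg := (hM.nonneg.mul hN.nonneg).mul (coeffNonneg_renewalSeries
    (hM.coeffNonneg_sub_one_mul_sub_one hN) (coeff_zero_sub_one_mul hM.coeff_zero))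
  coeff_zero := coeff_zero_freeMul hM.coeff_zero hN.coeff_zero
  coeff_one_pos := by
    have hN0 : 0 < coeff 0 N := one_pos.trans_eq hN.coeff_zero.symm
    have h := hM.coeff_freeMul_pos hN hM.coeff_one_pos hN0
    rwa [add_zero] at h
  unbounded K := by
    obtain ⟨ρ, hρ, hMρ, hNρ⟩ := hM.exists_isCriticalAt hN
    obtain ⟨z, hz, hzρ, hK⟩ := hρ.exists_lt_evalAt_renewalSeries
      (lt_max_of_lt_right one_pos : 0 < max K 1)
    have hMz := hMρ.mono hM.nonneg hz.le hzρ.le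
    have hNz := hNρ.mono hN.nonneg hz.le hzρ.le
    have hUz := hρ.summableAt_renewalSeries hz.le hzρ
    refine ⟨z, hz, (hMz.mul hNz).mul hUz, (le_max_left K 1).trans_lt (hK.trans_le ?_)⟩
    rw [freeMul, evalAt_mul (hMz.mul hNz) hUz, evalAt_mul hMz hNz]
    exact le_mul_of_one_le_left (evalAt_nonneg hρ.coeffNonneg_renewalSeries hz.le)
      (one_le_mul_of_one_le_of_one_le (hM.one_le_evalAt hz.le hMz) (hN.one_le_evalAt hz.le hNz))

theorem exists_tendsto_coeff_freeMul (hM : Supercritical M) (hN : Supercritical N)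
    (h2 : 0 < coeff 2 M ∨ 0 < coeff 2 N) : ∃ ρ, 0 < ρ ∧ ∃ A : ℝ, 0 < A ∧
      Tendsto (fun n => coeff n (freeMul M N) * ρ ^ n) atTop (𝓝 A) := by
  obtain ⟨ρ, hρ, hMρ, hNρ⟩ := hM.exists_isCriticalAt hN
  have hMpos {i j : ℕ} : 0 < coeff i (M - 1) → 0 < coeff j (N - 1) →
      0 < coeff (i + j) ((M - 1) * (N - 1)) :=
    hM.coeffNonneg_sub_one.coeff_mul_pos hN.coeffNonneg_sub_one
  have hpos_two : 0 < coeff (1 + 1) ((M - 1) * (N - 1)) :=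
    hMpos hM.coeff_one_sub_one_pos hN.coeff_one_sub_one_pos
  have hpos_three : 0 < coeff (1 + 1 + 1) ((M - 1) * (N - 1)) := by
    rcases h2 with h2 | h2 <;> rw [← coeff_sub_one two_ne_zero] at h2
    · exact hMpos h2 hN.coeff_one_sub_one_pos
    · rw [add_assoc]
      exact hMpos hM.coeff_one_sub_one_pos h2
  have hgcd : Nat.setGcd {k | 0 < coeff k ((M - 1) * (N - 1))} = 1 :=
    Nat.dvd_one.1 ((Nat.dvd_add_right (Nat.setGcd_dvd_of_mem hpos_two)).1
      (Nat.setGcd_dvd_of_mem hpos_three))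
  refine ⟨ρ, hρ.pos, hρ.exists_tendsto_coeff_mul_renewalSeries hgcd (hM.nonneg.mul hN.nonneg)
    (hMρ.mul hNρ) ?_⟩
  rw [evalAt_mul hMρ hNρ]
  exact mul_pos (one_pos.trans_le (hM.one_le_evalAt hρ.pos.le hMρ))
    (one_pos.trans_le (hN.one_le_evalAt hρ.pos.le hNρ))

protected theorem freeProd {M : ι → ℝ⟦X⟧} (hM : ∀ i, Supercritical (M i)) (hs : s.Nonempty) :
    Supercritical (freeProd s M) := by
  induction hs using Finset.Nonempty.cons_induction with
  | singleton i =>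
    rw [freeProd_singleton (hM i).coeff_zero]
    exact hM i
  | cons i s his _ ih =>
    rw [freeProd_cons (fun i => (hM i).coeff_zero) his]
    exact (hM i).freeMul ih

theorem exists_cons_eq_of_mem (hs : s.Nontrivial) (hi : i ∈ s) :
    ∃ (t : Finset ι) (hit : i ∉ t), t.Nonempty ∧ t.cons i hit = s := by
  classical
  refine ⟨s.erase i, s.notMem_erase i, hs.erase_nonempty, ?_⟩
  rw [Finset.cons_eq_insert, Finset.insert_erase hi]

theorem coeff_two_freeProd_pos {M : ι → ℝ⟦X⟧} (hM : ∀ i, Supercritical (M i))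
    (hs : s.Nontrivial) : 0 < coeff 2 (freeProd s M) := by
  obtain ⟨i, hi⟩ := hs.nonempty
  obtain ⟨t, hit, ht, rfl⟩ := exists_cons_eq_of_mem hs hi
  rw [freeProd_cons fun i => (hM i).coeff_zero]
  have ht := Supercritical.freeProd hM ht
  rw [← one_add_one_eq_two]
  exact (hM i).coeff_freeMul_pos ht (hM i).coeff_one_pos ht.coeff_one_pos

theorem exists_tendsto_coeff_freeProd {M : ι → ℝ⟦X⟧} (hM : ∀ i, Supercritical (M i))
    (hs : s.Nontrivial) (h : s.card ≠ 2 ∨ ∃ i ∈ s, 0 < coeff 2 (M i)) :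
    ∃ ρ, 0 < ρ ∧ ∃ A : ℝ, 0 < A ∧
      Tendsto (fun n => coeff n (freeProd s M) * ρ ^ n) atTop (𝓝 A) := by
  obtain ⟨i, hi, h2⟩ : ∃ i ∈ s, s.card ≠ 2 ∨ 0 < coeff 2 (M i) := by
    rcases h with h | ⟨i, hi, h⟩
    · obtain ⟨i, hi⟩ := hs.nonempty
      exact ⟨i, hi, Or.inl h⟩
    · exact ⟨i, hi, Or.inr h⟩
  obtain ⟨t, hit, ht, rfl⟩ := exists_cons_eq_of_mem hs hi
  rw [freeProd_cons fun i => (hM i).coeff_zero]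
  refine (hM i).exists_tendsto_coeff_freeMul (Supercritical.freeProd hM ht) ?_
  rcases h2 with hcard | h2
  · rw [Finset.card_cons] at hcard
    refine Or.inr (coeff_two_freeProd_pos hM (Finset.one_lt_card_iff_nontrivial.1 ?_))
    have := ht.card_pos
    lia
  · exact Or.inl h2

end Supercritical

end FreeMul

section SAWSeries

open PowerSeries

theorem exists_abscissa_of_submultiplicative {s : ℕ → ℝ} (hone : ∀ n, 1 ≤ s n)
    (hmul : ∀ m n, s (m + n) ≤ s m * s n) :
    ∃ R, 0 < R ∧ (∀ z, 0 < z → z < R → Summable fun n => s n * z ^ n) ∧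
      ¬ Summable fun n => s n * R ^ n := by
  have hpos : ∀ n, 0 < s n := fun n => one_pos.trans_le (hone n)
  have hsub : Subadditive fun n => Real.log (s n) := fun m n => by
    rw [← Real.log_mul (hpos m).ne' (hpos n).ne']
    exact Real.log_le_log (hpos _) (hmul m n)
  have hbdd : BddBelow (Set.range fun n : ℕ => Real.log (s n) / n) :=
    ⟨0, Set.forall_mem_range.2 fun n => div_nonneg (Real.log_nonneg (hone n)) n.cast_nonneg⟩
  refine ⟨Real.exp (-hsub.lim), Real.exp_pos _, fun z hz hzR => ?_, fun hsum => ?_⟩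
  · obtain ⟨c, hLc, hcz⟩ := exists_between (lt_neg_of_lt_neg ((Real.log_lt_iff_lt_exp hz).2 hzR))
    have hq : Real.exp c * z < 1 := by
      rw [← Real.exp_log hz, ← Real.exp_add, Real.exp_lt_one_iff]
      linarith
    refine (summable_geometric_of_lt_one (by positivity) hq).of_norm_bounded_eventually_nat ?_
    filter_upwards [(hsub.tendsto_lim hbdd).eventually_lt_const hLc, eventually_gt_atTop 0]
      with n hn hn0
    rw [div_lt_iff₀ (Nat.cast_pos.2 hn0), Real.log_lt_iff_lt_exp (hpos n), mul_comm,
      Real.exp_nat_mul] at hn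
    rw [Real.norm_of_nonneg (mul_nonneg (hpos n).le (pow_nonneg hz.le n)), mul_pow]
    gcongr
  · obtain ⟨n, hn, hn0⟩ := ((hsum.tendsto_atTop_zero.eventually_lt_const one_pos).and
      (eventually_gt_atTop 0)).exists
    have hle := hsub.lim_le_div hbdd hn0.ne'
    rw [le_div_iff₀ (Nat.cast_pos.2 hn0), Real.le_log_iff_exp_le (hpos n)] at hle
    refine hn.not_ge ?_
    calc (1 : ℝ) = Real.exp (hsub.lim * n) * Real.exp (-hsub.lim) ^ n := by
          rw [← Real.exp_nat_mul, ← Real.exp_add, ← Real.exp_zero]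
          congr 1
          ring
      _ ≤ s n * Real.exp (-hsub.lim) ^ n := by gcongr

theorem exists_lt_evalAt_of_eventually_eq_zero {F : ℝ⟦X⟧} (hF : CoeffNonneg F)
    (hone : 0 < coeff 1 F) {N : ℕ} (hN : ∀ n, N ≤ n → coeff n F = 0) (K : ℝ) :
    ∃ z, 0 < z ∧ SummableAt F z ∧ K < evalAt F z := by
  have hz : 0 < (|K| + 1) / coeff 1 F := by positivity
  have hs : SummableAt F ((|K| + 1) / coeff 1 F) :=
    summable_of_ne_finset_zero (s := Finset.range N) fun n hn => by
      rw [hN n (le_of_not_gt fun h => hn (Finset.mem_range.2 h)), zero_mul]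
  refine ⟨_, hz, hs, ?_⟩
  calc K < |K| + 1 := (le_abs_self K).trans_lt (lt_add_one _)
    _ = coeff 1 F * ((|K| + 1) / coeff 1 F) ^ 1 := by rw [pow_one, mul_div_cancel₀ _ hone.ne']
    _ ≤ evalAt F ((|K| + 1) / coeff 1 F) :=
        hs.le_tsum 1 fun n _ => mul_nonneg (hF n) (pow_nonneg hz.le n)

variable {W : Type*} {G : SimpleGraph W} {o x : W} {z : ℝ}

/-- The generating series of the self-avoiding walks from `o`. -/
noncomputable def sawSeries (G : SimpleGraph W) (o : W) : ℝ⟦X⟧ :=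
  mk fun n => (sawCount G o n : ℝ)

theorem coeff_sawSeries (G : SimpleGraph W) (o : W) (n : ℕ) :
    coeff n (sawSeries G o) = sawCount G o n :=
  coeff_mk _ _

theorem coeff_zero_sawSeries (G : SimpleGraph W) (o : W) : coeff 0 (sawSeries G o) = 1 := by
  rw [coeff_sawSeries, sawCount_zero, Nat.cast_one]

theorem coeffNonneg_sawSeries (G : SimpleGraph W) (o : W) : CoeffNonneg (sawSeries G o) :=
  fun n => (coeff_sawSeries G o n).symm ▸ Nat.cast_nonneg _

theorem summableAt_sawSeries_of_adj (hfin : ∀ x, (G.neighborSet x).Finite) (hxo : G.Adj x o)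
    (hz : 0 < z) (hs : SummableAt (sawSeries G o) z) : SummableAt (sawSeries G x) z := by
  have hshift : Summable fun n => z⁻¹ * (coeff (n + 1) (sawSeries G o) * z ^ (n + 1)) :=
    ((summable_nat_add_iff 1).2 hs).mul_left _
  refine Summable.of_nonneg_of_le
    (fun n => mul_nonneg (coeffNonneg_sawSeries G x n) (pow_nonneg hz.le n)) (fun n => ?_)
    (hshift.add (hs.mul hs))
  calc coeff n (sawSeries G x) * z ^ n
      ≤ (coeff (n + 1) (sawSeries G o) + coeff n (sawSeries G o * sawSeries G o)) * z ^ n := by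
        refine mul_le_mul_of_nonneg_right ?_ (pow_nonneg hz.le n)
        simp only [coeff_mul, coeff_sawSeries]
        exact_mod_cast sawCount_le_of_adj hfin hxo n
    _ = z⁻¹ * (coeff (n + 1) (sawSeries G o) * z ^ (n + 1)) +
          coeff n (sawSeries G o * sawSeries G o) * z ^ n := by
        field_simp
        ring

theorem summableAt_sawSeries_of_connected (hfin : ∀ x, (G.neighborSet x).Finite)
    (hconn : G.Connected) (hz : 0 < z) (hs : SummableAt (sawSeries G o) z) (x : W) :
    SummableAt (sawSeries G x) z := by
  obtain ⟨p⟩ := hconn.preconnected o x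
  induction p with
  | nil => exact hs
  | cons h _ ih => exact ih (summableAt_sawSeries_of_adj hfin h.symm hz hs)

theorem sawCount_one_pos [Nontrivial W] (hfin : ∀ x, (G.neighborSet x).Finite)
    (hconn : G.Connected) (o : W) : 0 < sawCount G o 1 := by
  rw [sawCount_one, Set.ncard_pos (hfin o)]
  exact hconn.preconnected.exists_adj_of_nontrivial o

/-- The numbers of walks of length `n` from a set of orbit representatives add up to a
submultiplicative sequence, and for every starting point the series has its radius of
convergence. -/
theorem exists_lt_evalAt_sawSeries (hfin : ∀ x, (G.neighborSet x).Finite) (hconn : G.Connected)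
    (hqt : IsQuasiTransitive G) (hpos : ∀ n, 0 < sawCount G o n) (K : ℝ) :
    ∃ z, 0 < z ∧ SummableAt (sawSeries G o) z ∧ K < evalAt (sawSeries G o) z := by
  obtain ⟨S, hSfin, hS⟩ := hqt
  lift S to Finset W using hSfin
  have hle : ∀ x n, sawCount G x n ≤ ∑ y ∈ S, sawCount G y n := by
    intro x n
    obtain ⟨y, hy, φ, rfl⟩ := hS x
    rw [sawCount_iso]
    exact Finset.single_le_sum (f := fun y => sawCount G y n) (fun _ _ => Nat.zero_le _) hy
  have hmul : ∀ m n, ∑ y ∈ S, sawCount G y (m + n) ≤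
      (∑ y ∈ S, sawCount G y m) * ∑ y ∈ S, sawCount G y n := by
    intro m n
    rw [Finset.sum_mul]
    exact Finset.sum_le_sum fun y _ => sawCount_add_le hfin y m n fun x => hle x n
  obtain ⟨R, hR, hlt, hnot⟩ := exists_abscissa_of_submultiplicative
    (s := fun n => ((∑ y ∈ S, sawCount G y n : ℕ) : ℝ))
    (fun n => by exact_mod_cast (hpos n).trans_le (hle o n)) (fun m n => by exact_mod_cast hmul m n)
  refine exists_lt_evalAt_of_not_summableAt (coeffNonneg_sawSeries G o) hR (fun z hz hzR => ?_)
    (fun hs => hnot ?_) K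
  · refine Summable.of_nonneg_of_le
      (fun n => mul_nonneg (coeffNonneg_sawSeries G o n) (pow_nonneg hz.le n)) (fun n => ?_)
      (hlt z hz hzR)
    rw [coeff_sawSeries]
    gcongr
    exact hle o n
  · refine (summable_sum fun y (_ : y ∈ S) =>
      summableAt_sawSeries_of_connected hfin hconn hR hs y).congr fun n => ?_
    simp only [coeff_sawSeries, Nat.cast_sum, Finset.sum_mul]

theorem supercritical_sawSeries [Nontrivial W] (hfin : ∀ x, (G.neighborSet x).Finite)
    (hconn : G.Connected) (hqt : IsQuasiTransitive G) (o : W) : Supercritical (sawSeries G o) where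
  nonneg := coeffNonneg_sawSeries G o
  coeff_zero := coeff_zero_sawSeries G o
  coeff_one_pos := by
    rw [coeff_sawSeries]
    exact_mod_cast sawCount_one_pos hfin hconn o
  unbounded K := by
    by_cases hpos : ∀ n, 0 < sawCount G o n
    · exact exists_lt_evalAt_sawSeries hfin hconn hqt hpos K
    · push Not at hpos
      obtain ⟨N, hN⟩ := hpos
      refine exists_lt_evalAt_of_eventually_eq_zero (coeffNonneg_sawSeries G o) ?_ (N := N)
        (fun n hn => ?_) K
      · rw [coeff_sawSeries]
        exact_mod_cast sawCount_one_pos hfin hconn o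
      · rw [coeff_sawSeries, sawCount_eq_zero_of_le hfin hn (Nat.le_zero.1 hN), Nat.cast_zero]

end SAWSeries

section Words

variable {ι : Type*} {V : ι → Type*} {o : ∀ i, V i} {i : ι} {x x' : V i} {w w' : Word o}

theorem single_root (o : ∀ i, V i) (i : ι) : single o i (o i) = [] := by
  rw [single, dif_pos rfl]

theorem single_of_ne (hx : x ≠ o i) : single o i x = [⟨i, x, hx⟩] := by
  rw [single, dif_neg hx]

theorem Word.ext_iff : w = w' ↔ w.1 = w'.1 :=
  Subtype.ext_iff

/-- The type of the last letter of a word, or `none` for the empty word. -/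
def Word.lastType (w : Word o) : Option ι :=
  w.1.getLast?.map Sigma.fst

theorem Word.lastType_empty : (Word.empty o).lastType = none :=
  rfl

theorem Word.lastType_eq_none_iff : w.lastType = none ↔ w = Word.empty o := by
  rw [Word.lastType, Option.map_eq_none_iff, List.getLast?_eq_none_iff, Word.ext_iff]
  rfl

theorem Word.lastType_ne_some_iff : w.lastType ≠ some i ↔ ∀ c ∈ w.1.getLast?, c.1 ≠ i := by
  rw [Word.lastType, ne_eq, Option.map_eq_some_iff, not_exists]
  exact forall_congr' fun c => not_and

theorem Word.isChain_append_single (hw : w.lastType ≠ some i) (x : V i) :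
    (w.1 ++ single o i x).IsChain fun a b => a.1 ≠ b.1 := by
  by_cases hx : x = o i
  · rw [hx, single_root, List.append_nil]
    exact w.2
  · rw [single_of_ne hx]
    refine w.2.append (List.isChain_singleton _) fun c hc d hd => ?_
    rw [List.head?_singleton, Option.mem_some_iff] at hd
    rw [← hd]
    exact Word.lastType_ne_some_iff.1 hw c hc

open Classical in
/-- The word `w x` for a vertex `x` of `V i`, where `w` must not end in a letter of type `i`; the
junk value is `w`. -/
noncomputable def Word.app (w : Word o) (i : ι) (x : V i) : Word o :=
  if hw : w.lastType ≠ some i then ⟨w.1 ++ single o i x, Word.isChain_append_single hw x⟩ else w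

theorem Word.val_app (hw : w.lastType ≠ some i) (x : V i) :
    (w.app i x).1 = w.1 ++ single o i x :=
  congrArg Subtype.val (dif_pos hw)

theorem Word.app_root (hw : w.lastType ≠ some i) : w.app i (o i) = w :=
  Word.ext_iff.2 (by rw [Word.val_app hw, single_root, List.append_nil])

theorem Word.lastType_app (hw : w.lastType ≠ some i) (hx : x ≠ o i) :
    (w.app i x).lastType = some i := by
  rw [Word.lastType, Word.val_app hw, single_of_ne hx, List.getLast?_concat, Option.map_some]

theorem Word.app_eq_app_iff (hw : w.lastType ≠ some i) (hw' : w'.lastType ≠ some i) :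
    w.app i x = w'.app i x' ↔ w = w' ∧ x = x' := by
  refine ⟨fun h => ?_, fun h => h.1 ▸ h.2 ▸ rfl⟩
  by_cases hx : x = o i <;> by_cases hx' : x' = o i
  · subst hx hx'
    rw [Word.app_root hw, Word.app_root hw'] at h
    exact ⟨h, rfl⟩
  · rw [hx, Word.app_root hw] at h
    exact absurd (h ▸ Word.lastType_app hw' hx') hw
  · rw [hx', Word.app_root hw'] at h
    exact absurd (h ▸ Word.lastType_app hw hx) hw'
  · rw [Word.ext_iff, Word.val_app hw, Word.val_app hw', single_of_ne hx, single_of_ne hx'] at h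
    obtain ⟨hww', hxx'⟩ := List.append_inj' h rfl
    exact ⟨Word.ext_iff.2 hww', by simpa using hxx'⟩

theorem Word.app_injective (hw : w.lastType ≠ some i) : Function.Injective (w.app i) :=
  fun _ _ h => ((Word.app_eq_app_iff hw hw).1 h).2

end Words

section Decomposition

variable {ι : Type*} {V : ι → Type*} {G : ∀ i, SimpleGraph (V i)} {o : ∀ i, V i} {i : ι}
  {a b w : Word o} {p t : List (Word o)}

theorem freeProduct_adj_iff : (freeProduct G o).Adj a b ↔ ∃ (w : Word o) (i : ι) (x y : V i),
    w.lastType ≠ some i ∧ (G i).Adj x y ∧ a = w.app i x ∧ b = w.app i y := by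
  refine exists₄_congr fun w i x y => ?_
  rw [← Word.lastType_ne_some_iff]
  refine and_congr_right fun hw => ?_
  rw [← Word.val_app hw, ← Word.val_app hw, Word.ext_iff, Word.ext_iff]

theorem finite_neighborSet_freeProduct [Finite ι] (hfin : ∀ i x, ((G i).neighborSet x).Finite)
    (a : Word o) : ((freeProduct G o).neighborSet a).Finite := by
  have hsub : ∀ i, {q : Word o × V i | q.1.lastType ≠ some i ∧ a = q.1.app i q.2}.Subsingleton :=
    fun i q hq q' hq' =>
      Prod.ext_iff.2 ((Word.app_eq_app_iff hq.1 hq'.1).1 (hq.2.symm.trans hq'.2))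
  refine (Set.finite_iUnion fun i => (hsub i).finite.biUnion fun q _ =>
    (hfin i q.2).image (q.1.app i)).subset fun b hab => ?_
  obtain ⟨w, i, x, y, hw, hxy, ha, rfl⟩ := freeProduct_adj_iff.1 hab
  exact Set.mem_iUnion.2 ⟨i, Set.mem_biUnion (show (w, x) ∈ _ from ⟨hw, ha⟩) ⟨y, hxy, rfl⟩⟩

/-- For each `i`, a self-avoiding walk is cut at the last word that does not end in type `i`, after
which it stays in one copy of `G i`. It cannot leave that copy through a vertex `a ≠ w`: the walk
up to a neighbour `a y` in a copy of another factor would already contain `a`. -/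
theorem exists_eq_map_app_append (hp : IsSAW (freeProduct G o) (Word.empty o) p) (i : ι) :
    ∃ (l : List (V i)) (w : Word o) (t : List (Word o)), IsSAW (G i) (o i) l ∧
      IsSAW (freeProduct G o) (Word.empty o) (w :: t) ∧ w.lastType ≠ some i ∧
        p = l.map (w.app i) ++ t := by
  induction p generalizing i with
  | nil => simpa using hp.getLast?
  | cons a p ih =>
    by_cases ha : a.lastType ≠ some i
    · exact ⟨[o i], a, p, isSAW_singleton.2 rfl, hp, ha, by simp [Word.app_root ha]⟩
    rw [not_not] at ha
    cases p with
    | nil =>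
      rw [isSAW_singleton.1 hp, Word.lastType_empty] at ha
      cases ha
    | cons b p =>
      obtain ⟨hab, hap, hbp⟩ := isSAW_cons_cons.1 hp
      obtain ⟨w, j, x, y, hw, hxy, rfl, rfl⟩ := freeProduct_adj_iff.1 hab
      obtain ⟨l, w', t, hl, hwt, hw', heq⟩ := ih hbp j
      obtain ⟨y', l, rfl⟩ := hl.exists_eq_cons
      obtain ⟨hhead, htail⟩ := List.cons.inj heq
      obtain ⟨rfl, rfl⟩ := (Word.app_eq_app_iff hw hw').1 hhead
      have hxl : x ∉ y :: l := fun hx => hap <| by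
        rw [heq]
        exact List.mem_append_left _ (List.mem_map_of_mem hx)
      have hx : x ≠ o j := fun hx => hxl (hx ▸ hl.mem)
      obtain rfl : j = i := Option.some_injective _ ((Word.lastType_app hw hx).symm.trans ha)
      exact ⟨x :: y :: l, w, t, isSAW_cons_cons.2 ⟨hxy, hxl, hl⟩, hwt, hw, by rw [heq]; rfl⟩

theorem mem_of_isSAW_app (hw : w.lastType ≠ some i) {x : V i}
    (hp : IsSAW (freeProduct G o) (Word.empty o) (w.app i x :: t)) : w ∈ w.app i x :: t := by
  obtain ⟨l, w', t', hl, -, hw', heq⟩ := exists_eq_map_app_append hp i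
  obtain ⟨x', l', rfl⟩ := hl.exists_eq_cons
  obtain ⟨rfl, -⟩ := (Word.app_eq_app_iff hw hw').1 (List.cons.inj heq).1
  have hmem : w.app i (o i) ∈ (x' :: l').map (w.app i) := List.mem_map_of_mem hl.mem
  rw [Word.app_root hw] at hmem
  rw [heq]
  exact List.mem_append_left _ hmem

theorem isSAW_map_app_append {l : List (V i)} (hl : IsSAW (G i) (o i) l)
    (hp : IsSAW (freeProduct G o) (Word.empty o) (w :: t)) (hw : w.lastType ≠ some i) :
    IsSAW (freeProduct G o) (Word.empty o) (l.map (w.app i) ++ t) := by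
  obtain ⟨q, rfl⟩ := hl.exists_eq_concat
  have hmap : IsSAW (freeProduct G o) w (q.map (w.app i) ++ [w]) := by
    have h := hl.map (Word.app_injective hw) fun x y hxy =>
      freeProduct_adj_iff.2 ⟨w, i, x, y, hw, hxy, rfl, rfl⟩
    rwa [List.map_append, List.map_singleton, Word.app_root hw] at h
  have hwt := (List.nodup_cons.1 hp.nodup).1
  rw [List.map_append, List.map_singleton, Word.app_root hw, List.append_assoc]
  refine hmap.append hp fun a ha hat => ?_
  have haw : a ≠ w := (List.nodup_append.1 hmap.nodup).2.2 a ha w (List.mem_singleton_self w)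
  obtain ⟨x, -, rfl⟩ := List.mem_map.1 ha
  obtain ⟨A, B, rfl⟩ := List.append_of_mem ((List.mem_cons.1 hat).resolve_left haw)
  rw [← List.cons_append] at hp
  exact hwt (List.mem_append_right _ (mem_of_isSAW_app hw hp.right_of_append))

theorem eq_of_map_app_append_eq {l l' : List (V i)} {w' : Word o} {t' : List (Word o)}
    (hl : IsSAW (G i) (o i) l) (hl' : IsSAW (G i) (o i) l') (hw : w.lastType ≠ some i)
    (hw' : w'.lastType ≠ some i) (hnd : (l.map (w.app i) ++ t).Nodup)
    (h : l.map (w.app i) ++ t = l'.map (w'.app i) ++ t') : l = l' ∧ w = w' ∧ t = t' := by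
  obtain rfl : w = w' := by
    obtain ⟨x, q, rfl⟩ := hl.exists_eq_cons
    obtain ⟨x', q', rfl⟩ := hl'.exists_eq_cons
    exact ((Word.app_eq_app_iff hw hw').1 (List.cons.inj h).1).1
  obtain ⟨q, rfl⟩ := hl.exists_eq_concat
  obtain ⟨q', rfl⟩ := hl'.exists_eq_concat
  simp only [List.map_append, List.map_singleton, Word.app_root hw, List.append_assoc,
    List.singleton_append] at h hnd
  obtain ⟨hwq, hwt⟩ := not_or.1 (List.mem_append.not.1 (List.nodup_cons.1
    (List.nodup_middle.1 hnd)).1)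
  obtain ⟨hqq', -, htt'⟩ := (List.append_cons_inj_of_notMem hwq hwt).1 h
  exact ⟨congrArg (· ++ [o i]) (List.map_injective_iff.2 (Word.app_injective hw) hqq'), rfl, htt'⟩

end Decomposition

section GeneratingSeries

open PowerSeries

variable {α β γ : Type*}

theorem ncard_eq_sum_ncard_fiber {s : Set α} (hs : s.Finite) {t : Finset β} {g : α → β}
    (hg : ∀ a ∈ s, g a ∈ t) : s.ncard = ∑ b ∈ t, {a ∈ s | g a = b}.ncard := by
  classical
  lift s to Finset α using hs
  rw [Set.ncard_coe_finset, Finset.card_eq_sum_card_fiberwise hg]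
  refine Finset.sum_congr rfl fun b _ => ?_
  rw [← Set.ncard_coe_finset, Finset.coe_filter]
  rfl

/-- The generating series of the elements of `S` graded by `deg`; a degree with infinitely many
elements contributes `0`. -/
noncomputable def genSeries (deg : α → ℕ) (S : Set α) : ℝ⟦X⟧ :=
  mk fun n => ({a ∈ S | deg a = n}.ncard : ℝ)

theorem coeff_genSeries (deg : α → ℕ) (S : Set α) (n : ℕ) :
    coeff n (genSeries deg S) = {a ∈ S | deg a = n}.ncard :=
  coeff_mk _ _

theorem genSeries_singleton {deg : α → ℕ} {a : α} (ha : deg a = 0) : genSeries deg {a} = 1 := by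
  ext n
  rw [coeff_genSeries, coeff_one]
  split_ifs with hn
  · rw [Nat.cast_eq_one, Set.ncard_eq_one]
    exact ⟨a, Set.ext fun b => ⟨fun hb => hb.1, fun hb => ⟨hb, by rw [hb, ha, hn]⟩⟩⟩
  · have hempty : {b ∈ ({a} : Set α) | deg b = n} = ∅ :=
      Set.eq_empty_of_forall_notMem fun b hb => hn (hb.2.symm.trans (hb.1 ▸ ha))
    rw [hempty, Set.ncard_empty, Nat.cast_zero]

theorem genSeries_eq_sum_fiber [Fintype β] {deg : α → ℕ} {S : Set α}
    (hS : ∀ n, {a ∈ S | deg a = n}.Finite) (g : α → β) :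
    genSeries deg S = ∑ b, genSeries deg {a ∈ S | g a = b} := by
  ext n
  rw [map_sum]
  simp only [coeff_genSeries]
  rw [ncard_eq_sum_ncard_fiber (hS n) fun a _ => Finset.mem_univ (g a), Nat.cast_sum]
  refine Finset.sum_congr rfl fun b _ => ?_
  congr 2 with a
  exact and_right_comm

theorem genSeries_add_genSeries_not {deg : α → ℕ} {S : Set α}
    (hS : ∀ n, {a ∈ S | deg a = n}.Finite) (p : α → Prop) :
    genSeries deg {a ∈ S | p a} + genSeries deg {a ∈ S | ¬ p a} = genSeries deg S := by
  rw [genSeries_eq_sum_fiber hS p, Fintype.sum_Prop]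
  simp only [eq_iff_iff, iff_true, iff_false]

theorem genSeries_eq_mul {degA : α → ℕ} {degB : β → ℕ} {degC : γ → ℕ} {S : Set α} {T : Set β}
    {R : Set γ} {f : α × β → γ} (hR : ∀ n, {c ∈ R | degC c = n}.Finite)
    (hf : Set.BijOn f (S ×ˢ T) R)
    (hdeg : ∀ a ∈ S, ∀ b ∈ T, degC (f (a, b)) = degA a + degB b) :
    genSeries degC R = genSeries degA S * genSeries degB T := by
  ext n
  have hbij : Set.BijOn f {q ∈ S ×ˢ T | degA q.1 + degB q.2 = n} {c ∈ R | degC c = n} := by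
    refine ⟨fun q hq => ⟨hf.mapsTo hq.1, (hdeg _ hq.1.1 _ hq.1.2).trans hq.2⟩,
      hf.injOn.mono fun q hq => hq.1, fun c hc => ?_⟩
    obtain ⟨q, hq, rfl⟩ := hf.surjOn hc.1
    exact ⟨q, ⟨hq, (hdeg _ hq.1 _ hq.2).symm.trans hc.2⟩, rfl⟩
  have hfin : {q ∈ S ×ˢ T | degA q.1 + degB q.2 = n}.Finite := hbij.finite_iff_finite.2 (hR n)
  rw [coeff_mul, coeff_genSeries, ← hbij.image_eq, hbij.injOn.ncard_image,
    ncard_eq_sum_ncard_fiber hfin (t := Finset.HasAntidiagonal.antidiagonal n)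
      (g := fun q => (degA q.1, degB q.2)) fun q hq =>
        Finset.HasAntidiagonal.mem_antidiagonal.2 hq.2, Nat.cast_sum]
  refine Finset.sum_congr rfl fun k hk => ?_
  rw [coeff_genSeries, coeff_genSeries, ← Nat.cast_mul, ← Set.ncard_prod]
  congr 2 with q
  have hkn := Finset.HasAntidiagonal.mem_antidiagonal.1 hk
  constructor
  · rintro ⟨⟨⟨ha, hb⟩, -⟩, rfl⟩
    exact ⟨⟨ha, rfl⟩, hb, rfl⟩
  · rintro ⟨⟨ha, hak⟩, hb, hbk⟩
    exact ⟨⟨⟨ha, hb⟩, by rw [hak, hbk, hkn]⟩, Prod.ext hak hbk⟩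

end GeneratingSeries

section FreeProductSeries

open PowerSeries

variable {W : Type*}

/-- The number of steps of a walk given by the list of its vertices. -/
def steps (l : List W) : ℕ :=
  l.length - 1

theorem setOf_isSAW_and_steps_eq (G : SimpleGraph W) (o : W) (n : ℕ) :
    {l ∈ {l | IsSAW G o l} | steps l = n} = saws G o n := by
  ext l
  refine and_congr_right fun hl => ?_
  obtain ⟨x, t, rfl⟩ := IsSAW.exists_eq_cons hl
  simp [steps]

theorem sawSeries_eq_genSeries (G : SimpleGraph W) (o : W) :
    sawSeries G o = genSeries steps {l | IsSAW G o l} := by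
  ext n
  rw [coeff_sawSeries, sawCount_eq_ncard, coeff_genSeries, setOf_isSAW_and_steps_eq]

variable {ι : Type*} {V : ι → Type*} {G : ∀ i, SimpleGraph (V i)} {o : ∀ i, V i}

/-- The type of the endpoint of a walk in a free product; walks are listed from their endpoint. -/
def endType (p : List (Word o)) : Option ι :=
  (p.headD (Word.empty o)).lastType

theorem finite_setOf_isSAW_freeProduct [Finite ι] (hfin : ∀ i x, ((G i).neighborSet x).Finite)
    (n : ℕ) : {p ∈ {p | IsSAW (freeProduct G o) (Word.empty o) p} | steps p = n}.Finite := by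
  rw [setOf_isSAW_and_steps_eq]
  exact finite_saws (finite_neighborSet_freeProduct hfin) _ n

theorem endType_eq_none_iff {p : List (Word o)}
    (hp : IsSAW (freeProduct G o) (Word.empty o) p) : endType p = none ↔ p = [Word.empty o] := by
  refine ⟨fun h => ?_, fun h => h ▸ rfl⟩
  obtain ⟨w, t, rfl⟩ := hp.exists_eq_cons
  obtain rfl := Word.lastType_eq_none_iff.1 h
  cases t with
  | nil => rfl
  | cons a t =>
    have hlast := hp.getLast?
    rw [List.getLast?_cons_cons] at hlast
    exact absurd (List.mem_of_getLast? hlast) (List.nodup_cons.1 hp.nodup).1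

theorem sawSeries_freeProduct_eq_one_add [Fintype ι]
    (hfin : ∀ i x, ((G i).neighborSet x).Finite) :
    sawSeries (freeProduct G o) (Word.empty o) = 1 + ∑ i, genSeries steps
      {p ∈ {p | IsSAW (freeProduct G o) (Word.empty o) p} | endType p = some i} := by
  have htrivial : {p ∈ {p | IsSAW (freeProduct G o) (Word.empty o) p} | endType p = none} =
      {[Word.empty o]} := by
    ext p
    exact ⟨fun hp => (endType_eq_none_iff hp.1).1 hp.2, fun hp => hp ▸
      ⟨isSAW_singleton.2 rfl, rfl⟩⟩
  rw [sawSeries_eq_genSeries, genSeries_eq_sum_fiber (finite_setOf_isSAW_freeProduct hfin) endType,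
    Fintype.sum_option, htrivial, genSeries_singleton]
  rfl

theorem sawSeries_freeProduct_eq_mul [Finite ι] (hfin : ∀ i x, ((G i).neighborSet x).Finite)
    (i : ι) :
    sawSeries (freeProduct G o) (Word.empty o) = sawSeries (G i) (o i) * genSeries steps
      {p ∈ {p | IsSAW (freeProduct G o) (Word.empty o) p} | endType p ≠ some i} := by
  rw [sawSeries_eq_genSeries, sawSeries_eq_genSeries]
  refine genSeries_eq_mul
    (f := fun q => q.1.map ((q.2.headD (Word.empty o)).app i) ++ q.2.tail)
    (finite_setOf_isSAW_freeProduct hfin) ⟨?_, ?_, ?_⟩ ?_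
  · rintro ⟨l, p⟩ ⟨hl, hp, hpi⟩
    obtain ⟨w, t, rfl⟩ := IsSAW.exists_eq_cons hp
    exact isSAW_map_app_append hl hp hpi
  · rintro ⟨l, p⟩ ⟨hl, hp, hpi⟩ ⟨l', p'⟩ ⟨hl', hp', hpi'⟩ h
    obtain ⟨w, t, rfl⟩ := IsSAW.exists_eq_cons hp
    obtain ⟨w', t', rfl⟩ := IsSAW.exists_eq_cons hp'
    obtain ⟨rfl, rfl, rfl⟩ := eq_of_map_app_append_eq hl hl' hpi hpi'
      (isSAW_map_app_append hl hp hpi).nodup h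
    rfl
  · intro p hp
    obtain ⟨l, w, t, hl, hwt, hw, rfl⟩ := exists_eq_map_app_append hp i
    exact ⟨(l, w :: t), ⟨hl, hwt, hw⟩, rfl⟩
  · intro l hl p hp
    obtain ⟨x, l, rfl⟩ := IsSAW.exists_eq_cons hl
    obtain ⟨w, t, rfl⟩ := IsSAW.exists_eq_cons hp.1
    simp [steps]

theorem sawSeries_freeProduct [Fintype ι] (hfin : ∀ i x, ((G i).neighborSet x).Finite) :
    sawSeries (freeProduct G o) (Word.empty o) =
      freeProd Finset.univ fun i => sawSeries (G i) (o i) := by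
  have hone (i : ι) : constantCoeff (sawSeries (G i) (o i)) = 1 :=
    (coeff_zero_eq_constantCoeff_apply _).symm.trans (coeff_zero_sawSeries _ _)
  rw [freeProd, PowerSeries.eq_inv_iff_mul_eq_one (by simp [hone]), mul_add, mul_one,
    Finset.mul_sum]
  have hterm (i : ι) : sawSeries (freeProduct G o) (Word.empty o) *
      ((sawSeries (G i) (o i))⁻¹ - 1) = -genSeries steps
        {p ∈ {p | IsSAW (freeProduct G o) (Word.empty o) p} | endType p = some i} := by
    have hmul := sawSeries_freeProduct_eq_mul (o := o) hfin i
    have hadd := genSeries_add_genSeries_not (finite_setOf_isSAW_freeProduct (o := o) hfin)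
      fun p => endType p = some i
    have hinv := PowerSeries.mul_inv_cancel (sawSeries (G i) (o i)) (by simp [hone])
    rw [← sawSeries_eq_genSeries] at hadd
    linear_combination (sawSeries (G i) (o i))⁻¹ * hmul + hadd + genSeries steps
      {p ∈ {p | IsSAW (freeProduct G o) (Word.empty o) p} | endType p ≠ some i} * hinv
  rw [Finset.sum_congr rfl fun i _ => hterm i, Finset.sum_neg_distrib]
  exact add_neg_eq_iff_eq_add.2 (sawSeries_freeProduct_eq_one_add hfin)

end FreeProductSeries

section Star

open PowerSeries

variable {W : Type*} {G : SimpleGraph W} {o x : W}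

theorem adj_of_sawCount_two_eq_zero (hfin : ∀ x, (G.neighborSet x).Finite) (hconn : G.Connected)
    (h2 : sawCount G o 2 = 0) (hx : x ≠ o) : G.Adj o x := by
  obtain ⟨p, hp⟩ := hconn.exists_isPath o x
  have hpos : sawCount G o p.length ≠ 0 := by
    rw [sawCount_eq_ncard]
    refine Set.ncard_ne_zero_of_mem ⟨isSAW_reverse_support p hp, ?_⟩ (finite_saws hfin o _)
    rw [List.length_reverse, SimpleGraph.Walk.length_support]
  have hlt : p.length < 2 := lt_of_not_ge fun hle => hpos (sawCount_eq_zero_of_le hfin hle h2)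
  have hne : p.length ≠ 0 := fun h => hx (SimpleGraph.Walk.eq_of_length_eq_zero h).symm
  exact SimpleGraph.Walk.adj_of_length_eq_one (p := p) (by lia)

theorem isStarAt_of_sawCount_two_eq_zero (hfin : ∀ x, (G.neighborSet x).Finite)
    (hconn : G.Connected) (h2 : sawCount G o 2 = 0) : IsStarAt G o := by
  intro x y hxy
  by_contra! ⟨hx, hy⟩
  have hox := adj_of_sawCount_two_eq_zero hfin hconn h2 hx
  have hmem : [y, x, o] ∈ saws G o 2 :=
    cons_cons_mem_saws.2 ⟨hxy.symm, by simp [hxy.ne', hy],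
      cons_cons_mem_saws.2 ⟨hox.symm, by simpa using hx, mem_saws_zero.2 rfl⟩⟩
  rw [sawCount_eq_ncard] at h2
  exact Set.ncard_ne_zero_of_mem hmem (finite_saws hfin o 2) h2

theorem card_eq_sawCount_one_add_one (hfin : ∀ x, (G.neighborSet x).Finite)
    (h : ∀ x, x ≠ o → G.Adj o x) : Nat.card W = sawCount G o 1 + 1 := by
  have huniv : insert o (G.neighborSet o) = Set.univ :=
    Set.eq_univ_of_forall fun x => or_iff_not_imp_left.2 (h x)
  rw [sawCount_one, ← Set.ncard_univ, ← huniv, Set.ncard_insert_of_notMem (by simp) (hfin o)]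

theorem sawSeries_eq_one_add_C_mul_X (hfin : ∀ x, (G.neighborSet x).Finite)
    (h2 : sawCount G o 2 = 0) : sawSeries G o = 1 + C (sawCount G o 1 : ℝ) * X := by
  ext n
  rw [coeff_sawSeries, map_add, coeff_one, coeff_C_mul, coeff_X]
  match n with
  | 0 => simp [sawCount_zero]
  | 1 => simp
  | n + 2 => simp [sawCount_eq_zero_of_le hfin (Nat.le_add_left 2 n) h2]

theorem mk_pow_mul_one_sub (d : ℝ) : mk (fun n => d ^ n) * (1 - C d * X) = 1 := by
  ext n
  rw [mul_sub, mul_one, mul_left_comm, map_sub, coeff_C_mul]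
  cases n with
  | zero => simp
  | succ n => simp [coeff_succ_mul_X, coeff_one, pow_succ']

variable {ι : Type*} {s : Finset ι} {d : ℝ}

theorem freeProd_one_add_C_mul_X (hs : s.card = 2) (d : ℝ) :
    freeProd s (fun _ => 1 + C d * X) = 2 * mk (fun n => d ^ n) - 1 := by
  symm
  have hinv : (1 + C d * X) * (1 + C d * X)⁻¹ = 1 := PowerSeries.mul_inv_cancel _ (by simp)
  rw [freeProd, Finset.sum_const, hs, two_nsmul, PowerSeries.eq_inv_iff_mul_eq_one (by simp)]
  linear_combination 2 * (1 + C d * X)⁻¹ * mk_pow_mul_one_sub d + 2 * mk (fun n => d ^ n) * hinv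

theorem exists_tendsto_coeff_freeProd_one_add_C_mul_X (hs : s.card = 2) (hd : 0 < d) :
    ∃ ρ, 0 < ρ ∧ ∃ A : ℝ, 0 < A ∧
      Tendsto (fun n => coeff n (freeProd s fun _ => 1 + C d * X) * ρ ^ n) atTop (𝓝 A) := by
  refine ⟨d⁻¹, inv_pos.2 hd, 2, two_pos, tendsto_const_nhds.congr' ?_⟩
  filter_upwards [eventually_ne_atTop 0] with n hn
  have hcoeff : coeff n (2 * mk fun n => d ^ n) = 2 * d ^ n := by
    rw [two_mul, map_add, coeff_mk, two_mul]
  rw [freeProd_one_add_C_mul_X hs, map_sub, hcoeff, coeff_one, if_neg hn, sub_zero, mul_assoc,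
    ← mul_pow, mul_inv_cancel₀ hd.ne', one_pow, mul_one]

variable [Fintype ι] {V : ι → Type*} {G : ∀ i, SimpleGraph (V i)} {o : ∀ i, V i}

theorem exists_tendsto_coeff_freeProd_of_sawCount_two_eq_zero (hι : Fintype.card ι = 2)
    (hnontrivial : ∀ i, Nontrivial (V i)) (hfin : ∀ i x, ((G i).neighborSet x).Finite)
    (hconn : ∀ i, (G i).Connected) (hcard : ∀ i j, Nat.card (V i) = Nat.card (V j))
    (h2 : ∀ i, sawCount (G i) (o i) 2 = 0) :
    ∃ ρ, 0 < ρ ∧ ∃ A : ℝ, 0 < A ∧ Tendsto (fun n =>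
      coeff n (freeProd Finset.univ fun i => sawSeries (G i) (o i)) * ρ ^ n) atTop (𝓝 A) := by
  obtain ⟨i₀⟩ : Nonempty ι := Fintype.card_pos_iff.1 (by lia)
  have := hnontrivial i₀
  have hcount (i : ι) : Nat.card (V i) = sawCount (G i) (o i) 1 + 1 :=
    card_eq_sawCount_one_add_one (hfin i) fun _ =>
      adj_of_sawCount_two_eq_zero (hfin i) (hconn i) (h2 i)
  have hlinear : (fun i => sawSeries (G i) (o i)) =
      fun _ => 1 + C (sawCount (G i₀) (o i₀) 1 : ℝ) * X := by
    funext i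
    have hdeg := hcard i i₀
    rw [hcount, hcount, Nat.add_right_cancel_iff] at hdeg
    rw [sawSeries_eq_one_add_C_mul_X (hfin i) (h2 i), hdeg]
  rw [hlinear]
  exact exists_tendsto_coeff_freeProd_one_add_C_mul_X hι
    (Nat.cast_pos.2 (sawCount_one_pos (hfin i₀) (hconn i₀) (o i₀)))

end Star

section Asymptotics

variable {W : Type*} {G : SimpleGraph W} {o : W} {ρ A : ℝ}

theorem isConnectiveConstant_of_tendsto (hρ : 0 < ρ) (hA : 0 < A)
    (h : Tendsto (fun n => (sawCount G o n : ℝ) * ρ ^ n) atTop (𝓝 A)) :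
    IsConnectiveConstant G o ρ⁻¹ := by
  have hroot := (h.rpow tendsto_one_div_atTop_nhds_zero_nat (Or.inl hA.ne')).mul_const ρ⁻¹
  rw [Real.rpow_zero, one_mul] at hroot
  refine hroot.congr' ?_
  filter_upwards [eventually_ne_atTop 0] with n hn
  rw [Real.mul_rpow (by positivity) (by positivity), one_div, Real.pow_rpow_inv_natCast hρ.le hn,
    mul_assoc, mul_inv_cancel₀ hρ.ne', mul_one]

theorem tendsto_sawCount_div (hA : 0 < A)
    (h : Tendsto (fun n => (sawCount G o n : ℝ) * ρ ^ n) atTop (𝓝 A)) :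
    Tendsto (fun n => (sawCount G o n : ℝ) / (A * ρ⁻¹ ^ n)) atTop (𝓝 1) := by
  rw [← div_self hA.ne']
  refine (h.div_const A).congr fun n => ?_
  rw [inv_pow, ← div_div, div_inv_eq_mul, mul_div_right_comm]

theorem eq_zero_of_tendsto_rpow {a L : ℝ} (hL : L ≠ 0)
    (h : Tendsto (fun n : ℕ => (n : ℝ) ^ a) atTop (𝓝 L)) : a = 0 := by
  have hcast := tendsto_natCast_atTop_atTop (R := ℝ)
  rcases lt_trichotomy a 0 with ha | ha | ha
  · have hzero := (tendsto_rpow_neg_atTop (neg_pos.2 ha)).comp hcast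
    rw [neg_neg] at hzero
    exact absurd (tendsto_nhds_unique h hzero) hL
  · exact ha
  · exact absurd h (not_tendsto_nhds_of_tendsto_atTop ((tendsto_rpow_atTop ha).comp hcast) L)

theorem isCriticalExponent_iff_of_tendsto (hρ : 0 < ρ) (hA : 0 < A)
    (h : Tendsto (fun n => (sawCount G o n : ℝ) * ρ ^ n) atTop (𝓝 A)) (γ : ℝ) :
    IsCriticalExponent G o γ ↔ γ = 1 := by
  have hconst := isConnectiveConstant_of_tendsto hρ hA h
  constructor
  · rintro ⟨μ, hμ, B, hB, hlim⟩
    obtain rfl := tendsto_nhds_unique hμ hconst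
    have hpow : Tendsto (fun n : ℕ => (n : ℝ) ^ (1 - γ)) atTop (𝓝 (A / B / 1)) := by
      refine ((h.div_const B).div hlim one_ne_zero).congr' ?_
      filter_upwards [eventually_gt_atTop 0, h.eventually_const_lt hA] with n hn hpos
      have hpow_pos : (0 : ℝ) < (n : ℝ) ^ (1 - γ) := Real.rpow_pos_of_pos (Nat.cast_pos.2 hn) _
      have hσ : (0 : ℝ) < sawCount G o n := pos_of_mul_pos_left hpos (by positivity)
      rw [Pi.div_apply, inv_pow]
      field_simp [hpow_pos.ne']
    exact (sub_eq_zero.1 (eq_zero_of_tendsto_rpow (by positivity) hpow)).symm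
  · rintro rfl
    exact ⟨ρ⁻¹, hconst, A, hA, by simpa using tendsto_sawCount_div hA h⟩

theorem exists_tendsto_sawCount_freeProduct {ι : Type*} [Fintype ι] (hι : 2 ≤ Fintype.card ι)
    {V : ι → Type*} {G : ∀ i, SimpleGraph (V i)} {o : ∀ i, V i}
    (hnontrivial : ∀ i, Nontrivial (V i)) (hfin : ∀ i x, ((G i).neighborSet x).Finite)
    (hconn : ∀ i, (G i).Connected) (hqt : ∀ i, IsQuasiTransitive (G i))
    (hstar : ¬ (Fintype.card ι = 2 ∧ (∀ i, IsStarAt (G i) (o i)) ∧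
      ∃ i j, Nat.card (V i) ≠ Nat.card (V j))) :
    ∃ ρ, 0 < ρ ∧ ∃ A : ℝ, 0 < A ∧ Tendsto (fun n =>
      (sawCount (freeProduct G o) (Word.empty o) n : ℝ) * ρ ^ n) atTop (𝓝 A) := by
  simp only [← coeff_sawSeries, sawSeries_freeProduct hfin]
  have hsuper (i : ι) : Supercritical (sawSeries (G i) (o i)) :=
    have := hnontrivial i
    supercritical_sawSeries (hfin i) (hconn i) (hqt i) (o i)
  by_cases h : Fintype.card ι ≠ 2 ∨ ∃ i, sawCount (G i) (o i) 2 ≠ 0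
  · refine Supercritical.exists_tendsto_coeff_freeProd hsuper
      (Finset.one_lt_card_iff_nontrivial.1 hι) (h.imp id ?_)
    rintro ⟨i, hi⟩
    refine ⟨i, Finset.mem_univ i, ?_⟩
    rw [coeff_sawSeries]
    exact Nat.cast_pos.2 (Nat.pos_of_ne_zero hi)
  · push Not at h
    obtain ⟨hcard, h2⟩ := h
    refine exists_tendsto_coeff_freeProd_of_sawCount_two_eq_zero hcard hnontrivial hfin hconn ?_ h2
    by_contra! hne
    exact hstar ⟨hcard, fun i => isStarAt_of_sawCount_two_eq_zero (hfin i) (hconn i) (h2 i), hne⟩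

end Asymptotics

end FreeProductSAW

theorem theorem4p1 {ι : Type*} [Fintype ι] (hι : 2 ≤ Fintype.card ι)
    {V : ι → Type*} (G : ∀ i, SimpleGraph (V i)) (o : ∀ i, V i)
    (hnontrivial : ∀ i, Nontrivial (V i))
    (hfin : ∀ i x, ((G i).neighborSet x).Finite)
    (hconn : ∀ i, (G i).Connected)
    (hqt : ∀ i, FreeProductSAW.IsQuasiTransitive (G i))
    (hstar : ¬ (Fintype.card ι = 2 ∧ (∀ i, FreeProductSAW.IsStarAt (G i) (o i)) ∧
      ∃ i j, Nat.card (V i) ≠ Nat.card (V j))) :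
    (∃ μ : ℝ, FreeProductSAW.IsConnectiveConstant (FreeProductSAW.freeProduct G o)
        (FreeProductSAW.Word.empty o) μ ∧
      ∃ A : ℝ, 0 < A ∧
        Tendsto (fun n : ℕ => (FreeProductSAW.sawCount (FreeProductSAW.freeProduct G o)
          (FreeProductSAW.Word.empty o) n : ℝ) / (A * μ ^ n)) atTop (𝓝 1)) ∧
    ∀ γ : ℝ, FreeProductSAW.IsCriticalExponent (FreeProductSAW.freeProduct G o)
      (FreeProductSAW.Word.empty o) γ ↔ γ = 1 := by
  obtain ⟨ρ, hρ, A, hA, h⟩ :=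
    FreeProductSAW.exists_tendsto_sawCount_freeProduct hι hnontrivial hfin hconn hqt hstar
  exact ⟨⟨ρ⁻¹, FreeProductSAW.isConnectiveConstant_of_tendsto hρ hA h, A, hA,
    FreeProductSAW.tendsto_sawCount_div hA h⟩,
    FreeProductSAW.isCriticalExponent_iff_of_tendsto hρ hA h⟩
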